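/- Let $n\ge 1$, let $J=(x,u,\partial u,\partial^2u,\dots)$ be the jet space of one dependent variable $u$ and $n$ independent variables $x=(x^1,\dots,x^n)$, and let $\Omega\subseteq J$ be open (for instance $\Omega=J$). A differential function is a smooth function on $\Omega$ of $x$ and finitely many of the derivatives of $u$. Write $D_i$ for the total derivatives, $f'=\sum_I \frac{\partial f}{\partial u_I}D_I$ for the Frechet derivative, $E_u$ for the Euler–Lagrange operator, $\mathrm{pr}\,X_P=\sum_I (D_IP)\,\frac{\partial}{\partial u_I}$, and ${}^*$ for the formal adjoint of a linear differential operator in total derivatives; $\mathrm{pr}\,X_P$ acts on such an operator through its coefficients, $\mathrm{pr}\,X_P\big(\sum_I W^I D_I\big)=\sum_I (\mathrm{pr}\,X_P W^I)D_I$. Let $G=E_u(L)$ for a differential function $L$. A differential function $P$ is (the characteristic of) a variational symmetry of the Euler–Lagrange equation $G=0$ if $\mathrm{pr}\,X_P(L)=\sum_i D_iA^i$ for some differential functions $A^i$, locally on $\Omega$. Let $Q$ be the characteristic of a symmetry of $G=0$, in the sense that $G'(Q)=R_Q(G)$ holds identically on $\Omega$ (not only on solutions) for some linear differential operator $R_Q$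 in total derivatives whose coefficients are differential functions ($Q$ need not be variational), and let $$S:=R_Q^*+Q'.$$ If $P$ is a variational symmetry of $G=0$, then $S(P)$ is also a variational symmetry of $G=0$ if and only if $$[S^*,P'^*]\,G=(\mathrm{pr}\,X_P S^*)\,G$$ holds identically on $\Omega$. -/

import Mathlib

open scoped ContDiff

/-! Calculus on the infinite jet space of one dependent variable `u` and `n` independent
variables `x`. -/

namespace JetCalculus

/-- A point of jet space `J = (x, u, ∂u, ∂²u, …)`: the values of the independent variables and of
all the jet variables `u_J`, indexed by multi-indices `J` (so `z.2 0` is `u` and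
`z.2 (Pi.single i 1)` is `u_{x^i}`). It carries the product topology. -/
abbrev Jet (n : ℕ) : Type := (Fin n → ℝ) × ((Fin n → ℕ) → ℝ)

/-- The coordinates of a jet consisting of `x` and of the `u_J` with `J ∈ s`. -/
def proj {n : ℕ} (s : Finset (Fin n → ℕ)) (z : Jet n) : (Fin n → ℝ) × (s → ℝ) :=
  (z.1, fun J => z.2 J)

/-- `f` is a differential function on the open set `Ω` of jet space: on `Ω` it is a smooth function
of `x` and of finitely many jet variables (equivalently of `x, u, …, ∂ᵏu` for some finite `k`).
The values of `f` off `Ω` are irrelevant. -/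
def IsDiffFun {n : ℕ} (Ω : Set (Jet n)) (f : Jet n → ℝ) : Prop :=
  ∃ (s : Finset (Fin n → ℕ)) (g : (Fin n → ℝ) × (s → ℝ) → ℝ),
    ContDiffOn ℝ ∞ g (proj s '' Ω) ∧ ∀ z ∈ Ω, f z = g (proj s z)

/-- The partial derivative `∂f/∂x^i`, all jet variables being held fixed. -/
noncomputable def partialX {n : ℕ} (i : Fin n) (f : Jet n → ℝ) (z : Jet n) : ℝ :=
  deriv (fun t : ℝ => f (Function.update z.1 i t, z.2)) (z.1 i)

/-- The partial derivative `∂f/∂u_J`. -/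
noncomputable def partialU {n : ℕ} (J : Fin n → ℕ) (f : Jet n → ℝ) (z : Jet n) : ℝ :=
  deriv (fun t : ℝ => f (z.1, Function.update z.2 J t)) (z.2 J)

/-- The total derivative `D_i = ∂/∂x^i + ∑_J u_{J,i} ∂/∂u_J`. For a differential function the sum
has only finitely many nonzero terms. -/
noncomputable def totalD {n : ℕ} (i : Fin n) (f : Jet n → ℝ) (z : Jet n) : ℝ :=
  partialX i f z + ∑ᶠ J : Fin n → ℕ, z.2 (J + Pi.single i 1) * partialU J f z

/-- The iterated total derivative `D_J = D_1^{J_1} ⋯ D_n^{J_n}`. -/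
noncomputable def multiD {n : ℕ} (J : Fin n → ℕ) (f : Jet n → ℝ) : Jet n → ℝ :=
  (List.finRange n).foldr (fun i g => (totalD i)^[J i] g) f

/-- The order `|J|` of a multi-index. -/
def order {n : ℕ} (J : Fin n → ℕ) : ℕ := ∑ i, J i

/-- The coefficient family `(a_J)_J` of an operator `∑_J a_J D_J`. -/
abbrev Op (n : ℕ) : Type := (Fin n → ℕ) → Jet n → ℝ

/-- `∑_J a_J D_J` is a linear differential operator in total derivatives on `Ω`: the coefficients
are differential functions on `Ω` and only finitely many of them are nonzero there. -/
def IsDiffOp {n : ℕ} (Ω : Set (Jet n)) (a : Op n) : Prop :=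
  (∀ J, IsDiffFun Ω (a J)) ∧ ∃ s : Finset (Fin n → ℕ), ∀ J, J ∉ s → ∀ z ∈ Ω, a J z = 0

/-- The action of an operator: `(∑_J a_J D_J) f`. -/
noncomputable def Op.app {n : ℕ} (a : Op n) (f : Jet n → ℝ) (z : Jet n) : ℝ :=
  ∑ᶠ J : Fin n → ℕ, a J z * multiD J f z

/-- The formal adjoint `a* = ∑_J (-1)^{|J|} D_J ∘ a_J`, brought by the Leibniz rule into the form
`∑_K W^K D_K` with `W^K = ∑_J (-1)^{|K+J|} binom(K+J, K) D_J (a_{K+J})`. -/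
noncomputable def Op.adj {n : ℕ} (a : Op n) : Op n := fun K z =>
  ∑ᶠ J : Fin n → ℕ, (-1 : ℝ) ^ order (K + J) * (∏ i, ((K i + J i).choose (K i) : ℝ)) *
    multiD J (a (K + J)) z

/-- The Frechet derivative `f' = ∑_J (∂f/∂u_J) D_J`. -/
noncomputable def frechet {n : ℕ} (f : Jet n → ℝ) : Op n := fun J => partialU J f

/-- The prolongation `pr X_P = ∑_J (D_J P) ∂/∂u_J` of the vector field `P ∂_u`, acting on
functions; thus `pr X_P f = f'(P)`. -/
noncomputable def pr {n : ℕ} (P f : Jet n → ℝ) (z : Jet n) : ℝ :=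
  ∑ᶠ J : Fin n → ℕ, multiD J P z * partialU J f z

/-- The prolongation acting on the coefficients of an operator:
`pr X_P (∑_J W^J D_J) = ∑_J (pr X_P W^J) D_J`. -/
noncomputable def prOp {n : ℕ} (P : Jet n → ℝ) (a : Op n) : Op n := fun J => pr P (a J)

/-- The Euler-Lagrange operator `E_u f = ∑_J (-1)^{|J|} D_J (∂f/∂u_J)`. -/
noncomputable def euler {n : ℕ} (f : Jet n → ℝ) (z : Jet n) : ℝ :=
  ∑ᶠ J : Fin n → ℕ, (-1 : ℝ) ^ order J * multiD J (partialU J f) z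

/-- `f` is a total divergence `∑_i D_i A^i` of differential functions, near every point of `Ω`. -/
def IsTotalDivergence {n : ℕ} (Ω : Set (Jet n)) (f : Jet n → ℝ) : Prop :=
  ∀ z ∈ Ω, ∃ V : Set (Jet n), IsOpen V ∧ z ∈ V ∧ V ⊆ Ω ∧
    ∃ A : Fin n → Jet n → ℝ, (∀ i, IsDiffFun V (A i)) ∧ ∀ w ∈ V, f w = ∑ i, totalD i (A i) w

/-- `P ∂_u` is a variational symmetry of the Euler-Lagrange equation `E_u(L) = 0` on `Ω`: a
symmetry of the Lagrangian, i.e. `P` is a differential function and `pr X_P L` is a total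
divergence. -/
def IsVariationalSymmetry {n : ℕ} (Ω : Set (Jet n)) (L P : Jet n → ℝ) : Prop :=
  IsDiffFun Ω P ∧ IsTotalDivergence Ω (pr P L)

/-- The operator `S = R* + Q'` attached to a symmetry `Q ∂_u` of `G = 0` with `G'(Q) = R(G)`. -/
noncomputable def recursionOp {n : ℕ} (R : Op n) (Q : Jet n → ℝ) : Op n := R.adj + frechet Q

end JetCalculus

/-! Write E for the Euler operator, so G = E(L). Integration by parts shows that pr X_P f and E(f) P
differ by a total divergence, and E kills divergences, so E(pr X_P f) = E(E(f) P). Expanding the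
left side termwise gives pr X_P(E f) + P'^*(E f) (`E_pr`); expanding the right side by E(fg) = f'^*
g + g'^* f and comparing shows that the Frechet derivative of E(f) is self-adjoint (`adjApp_dU_E`).

Put M = S^* G. Since S^* = R + Q'^*, the symmetry condition gives M = G'(Q) + Q'^* G = E(pr X_Q L).
So M is again an Euler-Lagrange expression, whether or not Q is variational, and M' is self-adjoint.
Therefore E(pr X_{SP} L) = E(G S(P)) = E(M P) = pr X_P M + P'^* M. Expanding pr X_P(S^* G) by the
Leibniz rule and inserting pr X_P G = -P'^* G, which expresses that E(pr X_P L) = 0, turns this into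
(pr X_P S^*) G - [S^*, P'^*] G (`E_pr_recursion`).

It remains to know that E(F) = 0 exactly when F is locally a total divergence. The nontrivial
direction (`isTotalDivergence_of_euler_eq_zero`) is a homotopy argument: near a given jet, contract
the fibres onto a holonomic section w. Because w is holonomic, averaging along the contraction
commutes with every D_i, so F minus its restriction to w becomes a divergence. The restriction
depends on x alone and is a divergence by integration in one variable.

The identities are proved in an abstract algebra with commuting derivations (`JetAlgebra`), where
sums are finite and equality on Ω is plain equality. `jetAlgebra` realizes it by differential
functions on Ω, and `Rep` carries the results back to functions on jet space. -/

namespace JetCalculus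

/-! ### Jet algebras: vertical derivations and total derivatives -/

/-- The algebraic structure carried by an algebra of differential functions: commuting
derivations `∂/∂x^i` and `∂/∂u_J`, and the coordinate functions `u_J`. -/
structure JetAlgebra (n : ℕ) (A : Type*) [CommRing A] [Algebra ℝ A] where
  X : Fin n → Derivation ℝ A A
  U : (Fin n → ℕ) → Derivation ℝ A A
  u : (Fin n → ℕ) → A
  X_comm : ∀ i j f, X i (X j f) = X j (X i f)
  U_comm : ∀ J K f, U J (U K f) = U K (U J f)
  XU_comm : ∀ i J f, X i (U J f) = U J (X i f)
  U_u : ∀ J K, U J (u K) = if J = K then 1 else 0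
  X_u : ∀ i J, X i (u J) = 0
  finite : ∀ f, {J | U J f ≠ 0}.Finite

theorem multiIndex_induction {n : ℕ} {p : (Fin n → ℕ) → Prop} (h0 : p 0)
    (hs : ∀ J i, p J → p (J + Pi.single i 1)) (J : Fin n → ℕ) : p J := by
  obtain ⟨m, hm⟩ : ∃ m, order J = m := ⟨_, rfl⟩
  induction m generalizing J with
  | zero =>
    have : J = 0 := by
      funext i
      simpa using (Finset.sum_eq_zero_iff.1 hm) i (Finset.mem_univ i)
    rwa [this]
  | succ m ih =>
    obtain ⟨i, hi⟩ : ∃ i, J i ≠ 0 := by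
      by_contra! h
      simp [order, h] at hm
    have hJ : J = (J - Pi.single i 1) + Pi.single i 1 := by
      funext j
      by_cases hj : j = i
      · subst hj; simp; omega
      · simp [hj]
    rw [hJ]
    apply hs
    apply ih
    rw [hJ] at hm
    simp only [order, Pi.add_apply, Finset.sum_add_distrib, Finset.sum_pi_single'] at hm ⊢
    simpa using hm

theorem order_add_single {n : ℕ} (J : Fin n → ℕ) (i : Fin n) :
    order (J + Pi.single i 1) = order J + 1 := by
  simp [order, Finset.sum_add_distrib]

namespace JetAlgebra

variable {n : ℕ} {A : Type*} [CommRing A] [Algebra ℝ A] (𝒥 : JetAlgebra n A)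

/-- The gradient `J ↦ ∂f/∂u_J`, i.e. the Frechet derivative as an operator. -/
noncomputable def dU : A →ₗ[ℝ] ((Fin n → ℕ) →₀ A) where
  toFun f := Finsupp.ofSupportFinite (fun J => 𝒥.U J f) (𝒥.finite f)
  map_add' f g := by ext J; exact map_add (𝒥.U J) f g
  map_smul' c f := by ext J; exact Derivation.map_smul _ _ _

@[simp] theorem dU_apply (f : A) (J : Fin n → ℕ) : 𝒥.dU f J = 𝒥.U J f := rfl

/-- The linear map `f ↦ ∑_J ∂f/∂u_J φ_J`. -/
noncomputable def vertLin (φ : (Fin n → ℕ) → A) : A →ₗ[ℝ] A :=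
  (Finsupp.lsum ℝ fun J => LinearMap.mulRight ℝ (φ J)) ∘ₗ 𝒥.dU

theorem vertLin_eq_sum (φ : (Fin n → ℕ) → A) (f : A) {s : Finset (Fin n → ℕ)}
    (hs : ∀ J, J ∉ s → 𝒥.U J f = 0) : 𝒥.vertLin φ f = ∑ J ∈ s, 𝒥.U J f * φ J := by
  simp only [vertLin, LinearMap.comp_apply, Finsupp.lsum_apply]
  rw [Finsupp.sum_of_support_subset (s := s)]
  · simp
  · intro J hJ
    by_contra h
    simp [hs J h] at hJ
  · simp

theorem exists_support (f : A) : ∃ s : Finset (Fin n → ℕ), ∀ J, J ∉ s → 𝒥.U J f = 0 :=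
  ⟨(𝒥.finite f).toFinset, fun J hJ => by simpa using hJ⟩

theorem exists_support₂ (f g : A) :
    ∃ s : Finset (Fin n → ℕ), (∀ J, J ∉ s → 𝒥.U J f = 0) ∧ ∀ J, J ∉ s → 𝒥.U J g = 0 := by
  classical
  obtain ⟨s, hs⟩ := 𝒥.exists_support f
  obtain ⟨t, ht⟩ := 𝒥.exists_support g
  exact ⟨s ∪ t, fun J hJ => hs J fun h => hJ (Finset.mem_union_left _ h),
    fun J hJ => ht J fun h => hJ (Finset.mem_union_right _ h)⟩

/-- The vertical derivation `∑_J φ_J ∂/∂u_J`. -/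
noncomputable def vert (φ : (Fin n → ℕ) → A) : Derivation ℝ A A :=
  Derivation.mk' (𝒥.vertLin φ) fun f g => by
    obtain ⟨s, hf, hg⟩ := 𝒥.exists_support₂ f g
    rw [𝒥.vertLin_eq_sum φ f hf, 𝒥.vertLin_eq_sum φ g hg, 𝒥.vertLin_eq_sum φ (f * g) (s := s),
      Finset.smul_sum, Finset.smul_sum, ← Finset.sum_add_distrib]
    · refine Finset.sum_congr rfl fun J _ => ?_
      simp only [Derivation.leibniz, smul_eq_mul]; ring
    · intro J hJ; simp [hf J hJ, hg J hJ]

theorem vert_eq_sum (φ : (Fin n → ℕ) → A) (f : A) {s : Finset (Fin n → ℕ)}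
    (hs : ∀ J, J ∉ s → 𝒥.U J f = 0) : 𝒥.vert φ f = ∑ J ∈ s, 𝒥.U J f * φ J :=
  𝒥.vertLin_eq_sum φ f hs

theorem vert_u (φ : (Fin n → ℕ) → A) (K : Fin n → ℕ) : 𝒥.vert φ (𝒥.u K) = φ K := by
  rw [𝒥.vert_eq_sum φ (𝒥.u K) (s := {K})]
  · simp [𝒥.U_u]
  · intro J hJ
    simp at hJ
    simp [𝒥.U_u, hJ]

theorem derivation_vert (δ : Derivation ℝ A A) (φ : (Fin n → ℕ) → A) (f : A)
    {s : Finset (Fin n → ℕ)} (hs : ∀ J, J ∉ s → 𝒥.U J f = 0) :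
    δ (𝒥.vert φ f) = 𝒥.vert (fun J => δ (φ J)) f + ∑ J ∈ s, δ (𝒥.U J f) * φ J := by
  rw [𝒥.vert_eq_sum φ f hs, 𝒥.vert_eq_sum _ f hs, map_sum, ← Finset.sum_add_distrib]
  refine Finset.sum_congr rfl fun J _ => ?_
  simp only [Derivation.leibniz, smul_eq_mul]; ring

theorem commuting_vert (δ : Derivation ℝ A A) (hδ : ∀ J f, δ (𝒥.U J f) = 𝒥.U J (δ f))
    (φ : (Fin n → ℕ) → A) (f : A) :
    δ (𝒥.vert φ f) = 𝒥.vert (fun J => δ (φ J)) f + 𝒥.vert φ (δ f) := by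
  obtain ⟨s, hs⟩ := 𝒥.exists_support f
  rw [𝒥.derivation_vert δ φ f hs, 𝒥.vert_eq_sum φ (δ f) (s := s)]
  · simp [hδ]
  · intro J hJ; rw [← hδ, hs J hJ, map_zero]

/-- Vector-field bracket: the second-order terms cancel because the ∂/∂u_J commute. -/
theorem vert_vert (ψ φ : (Fin n → ℕ) → A) (f : A) :
    𝒥.vert ψ (𝒥.vert φ f) - 𝒥.vert φ (𝒥.vert ψ f) =
      𝒥.vert (fun J => 𝒥.vert ψ (φ J) - 𝒥.vert φ (ψ J)) f := by
  obtain ⟨s, hs⟩ := 𝒥.exists_support f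
  have hs' : ∀ K, ∀ J, J ∉ s → 𝒥.U J (𝒥.U K f) = 0 := fun K J hJ => by
    rw [𝒥.U_comm, hs J hJ, map_zero]
  have key : ∑ J ∈ s, 𝒥.vert ψ (𝒥.U J f) * φ J = ∑ J ∈ s, 𝒥.vert φ (𝒥.U J f) * ψ J := by
    simp_rw [𝒥.vert_eq_sum ψ _ (hs' _), 𝒥.vert_eq_sum φ _ (hs' _), Finset.sum_mul]
    rw [Finset.sum_comm]
    refine Finset.sum_congr rfl fun J _ => Finset.sum_congr rfl fun K _ => ?_
    rw [𝒥.U_comm]; ring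
  rw [𝒥.derivation_vert _ φ f hs, 𝒥.derivation_vert _ ψ f hs, key, 𝒥.vert_eq_sum _ f hs,
    𝒥.vert_eq_sum _ f hs, 𝒥.vert_eq_sum _ f hs]
  simp only [mul_sub, Finset.sum_sub_distrib]
  ring

/-- The total derivative. -/
noncomputable def D (i : Fin n) : Derivation ℝ A A :=
  𝒥.X i + 𝒥.vert fun J => 𝒥.u (J + Pi.single i 1)

theorem D_apply (i : Fin n) (f : A) :
    𝒥.D i f = 𝒥.X i f + 𝒥.vert (fun J => 𝒥.u (J + Pi.single i 1)) f := rfl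

theorem D_u (i : Fin n) (J : Fin n → ℕ) : 𝒥.D i (𝒥.u J) = 𝒥.u (J + Pi.single i 1) := by
  rw [D_apply, vert_u, X_u, zero_add]

/-- The correction coefficients D_i φ_J - φ_{J+i} vanish when φ_J = D_J P. This is why prolongations
commute with total derivatives (`pr_D`). -/
theorem D_vert (i : Fin n) (φ : (Fin n → ℕ) → A) (f : A) :
    𝒥.D i (𝒥.vert φ f) =
      𝒥.vert (fun J => 𝒥.D i (φ J) - φ (J + Pi.single i 1)) f + 𝒥.vert φ (𝒥.D i f) := by
  have h1 := 𝒥.commuting_vert (𝒥.X i) (𝒥.XU_comm i) φ f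
  have h2 := 𝒥.vert_vert (fun J => 𝒥.u (J + Pi.single i 1)) φ f
  simp only [vert_u] at h2
  rw [D_apply, D_apply, h1, sub_eq_iff_eq_add.1 h2, map_add]
  obtain ⟨s, hs⟩ := 𝒥.exists_support f
  have : 𝒥.vert (fun J => 𝒥.D i (φ J) - φ (J + Pi.single i 1)) f =
      𝒥.vert (fun J => 𝒥.X i (φ J)) f +
      𝒥.vert (fun J => 𝒥.vert (fun J => 𝒥.u (J + Pi.single i 1)) (φ J)
        - φ (J + Pi.single i 1)) f := by
    rw [𝒥.vert_eq_sum _ f hs, 𝒥.vert_eq_sum _ f hs, 𝒥.vert_eq_sum _ f hs,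
      ← Finset.sum_add_distrib]
    refine Finset.sum_congr rfl fun J _ => ?_
    rw [D_apply]; ring
  rw [this]
  ring

theorem D_comm (i j : Fin n) (f : A) : 𝒥.D i (𝒥.D j f) = 𝒥.D j (𝒥.D i f) := by
  have h1 := 𝒥.D_vert i (fun J => 𝒥.u (J + Pi.single j 1)) f
  have h2 := 𝒥.commuting_vert (𝒥.X j) (𝒥.XU_comm j) (fun J => 𝒥.u (J + Pi.single i 1)) f
  have h3 : ∀ φ : (Fin n → ℕ) → A, (∀ J, φ J = 0) → 𝒥.vert φ f = 0 := fun φ h => by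
    obtain ⟨s, hs⟩ := 𝒥.exists_support f
    simp [𝒥.vert_eq_sum φ f hs, h]
  rw [h3 (fun J : Fin n → ℕ => 𝒥.D i (𝒥.u (J + (Pi.single j 1 : Fin n → ℕ))) -
      𝒥.u (J + (Pi.single i 1 : Fin n → ℕ) + (Pi.single j 1 : Fin n → ℕ)))
    fun J => by rw [𝒥.D_u, add_right_comm, sub_self]] at h1
  rw [h3 _ fun J => 𝒥.X_u _ _] at h2
  rw [D_apply (i := j), map_add, h1, D_apply (i := j) (f := 𝒥.D i f),
    D_apply (i := i), D_apply (i := i)]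
  simp only [map_add, h2]
  rw [𝒥.X_comm]
  ring

theorem U_D (K : Fin n → ℕ) (i : Fin n) (f : A) :
    𝒥.U K (𝒥.D i f) = 𝒥.D i (𝒥.U K f) +
      𝒥.vert (fun J => if K = J + Pi.single i 1 then 1 else 0) f := by
  have h := 𝒥.commuting_vert (𝒥.U K) (fun J f => 𝒥.U_comm K J f)
    (fun J => 𝒥.u (J + Pi.single i 1)) f
  simp only [𝒥.U_u] at h
  rw [D_apply, map_add, h, D_apply, 𝒥.XU_comm]
  ring

/-- The iterated total derivative `D_J`. -/
noncomputable def DD (J : Fin n → ℕ) : A →ₗ[ℝ] A :=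
  ((List.finRange n).map fun i => ((𝒥.D i : A →ₗ[ℝ] A) : Module.End ℝ A) ^ J i).prod

@[simp] theorem DD_zero (f : A) : 𝒥.DD 0 f = f := by
  have : ((List.finRange n).map fun i =>
      ((𝒥.D i : A →ₗ[ℝ] A) : Module.End ℝ A) ^ (0 : Fin n → ℕ) i).prod = 1 := by
    apply List.prod_eq_one; simp
  rw [DD, this]; rfl

theorem DD_add_single (J : Fin n → ℕ) (i : Fin n) (f : A) :
    𝒥.DD (J + Pi.single i 1) f = 𝒥.D i (𝒥.DD J f) := by
  let E : Fin n → Module.End ℝ A := fun j => (𝒥.D j : A →ₗ[ℝ] A)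
  have hE : ∀ j k, Commute (E j) (E k) := fun j k => by
    ext f; exact 𝒥.D_comm j k f
  -- Each index occurs once in the list, so raising the exponent of i adds a single factor D_i,
  -- which commutes to the front.
  have key : ∀ l : List (Fin n), l.Nodup →
      (l.map fun j => E j ^ (J + Pi.single i 1 : Fin n → ℕ) j).prod =
        if i ∈ l then E i * (l.map fun j => E j ^ J j).prod
        else (l.map fun j => E j ^ J j).prod := by
    intro l hl
    induction l with
    | nil => simp
    | cons a l ih =>
      rw [List.nodup_cons] at hl
      simp only [List.map_cons, List.prod_cons, ih hl.2, List.mem_cons]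
      by_cases ha : i = a
      · subst ha
        simp [hl.1, pow_succ', mul_assoc]
      · have ha' : a ≠ i := fun h => ha h.symm
        by_cases hi : i ∈ l
        · simp only [hi, or_true, if_true, Pi.add_apply, Pi.single_eq_of_ne ha', add_zero]
          rw [← mul_assoc, ← mul_assoc, ((hE i a).pow_right (J a)).eq]
        · simp [hi, ha, ha']
  have := key (List.finRange n) (List.nodup_finRange n)
  simp only [List.mem_finRange, if_true] at this
  rw [DD, DD]
  exact congrArg (fun T : Module.End ℝ A => T f) this

theorem DD_D (J : Fin n → ℕ) (i : Fin n) (f : A) : 𝒥.DD J (𝒥.D i f) = 𝒥.D i (𝒥.DD J f) := by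
  induction J using multiIndex_induction with
  | h0 => simp
  | hs J j ih => rw [DD_add_single, ih, DD_add_single, D_comm]

/-! ### Operators in total derivatives, formal adjoints, integration by parts -/

/-- The action `(∑_J a_J D_J) f`, linear in the operator. -/
noncomputable def app (f : A) : ((Fin n → ℕ) →₀ A) →ₗ[ℝ] A :=
  Finsupp.lsum ℝ fun J => LinearMap.mulRight ℝ (𝒥.DD J f)

/-- The action of the formal adjoint, `∑_J (-1)^{|J|} D_J (a_J f)`. -/
noncomputable def adjApp (f : A) : ((Fin n → ℕ) →₀ A) →ₗ[ℝ] A :=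
  Finsupp.lsum ℝ fun J => (-1 : ℝ) ^ order J • (𝒥.DD J ∘ₗ LinearMap.mulRight ℝ f)

@[simp] theorem app_single (f : A) (J : Fin n → ℕ) (c : A) :
    𝒥.app f (Finsupp.single J c) = c * 𝒥.DD J f := by simp [app]

@[simp] theorem adjApp_single (f : A) (J : Fin n → ℕ) (c : A) :
    𝒥.adjApp f (Finsupp.single J c) = (-1 : ℝ) ^ order J • 𝒥.DD J (c * f) := by simp [adjApp]

theorem app_eq_sum (f : A) (a : (Fin n → ℕ) →₀ A) {s : Finset (Fin n → ℕ)}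
    (hs : ∀ J, J ∉ s → a J = 0) : 𝒥.app f a = ∑ J ∈ s, a J * 𝒥.DD J f := by
  rw [app, Finsupp.lsum_apply, Finsupp.sum_of_support_subset (s := s)]
  · rfl
  · intro J hJ
    by_contra h
    simp [hs J h] at hJ
  · simp

theorem adjApp_eq_sum (f : A) (a : (Fin n → ℕ) →₀ A) {s : Finset (Fin n → ℕ)}
    (hs : ∀ J, J ∉ s → a J = 0) :
    𝒥.adjApp f a = ∑ J ∈ s, (-1 : ℝ) ^ order J • 𝒥.DD J (a J * f) := by
  rw [adjApp, Finsupp.lsum_apply, Finsupp.sum_of_support_subset (s := s)]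
  · rfl
  · intro J hJ
    by_contra h
    simp [hs J h] at hJ
  · simp

/-- The composite `D_i ∘ a`. -/
noncomputable def comp (i : Fin n) : ((Fin n → ℕ) →₀ A) →ₗ[ℝ] ((Fin n → ℕ) →₀ A) :=
  Finsupp.lmapDomain A ℝ (fun J => J + Pi.single i 1) +
    Finsupp.mapRange.linearMap (𝒥.D i : A →ₗ[ℝ] A)

theorem comp_single (i : Fin n) (J : Fin n → ℕ) (c : A) :
    𝒥.comp i (Finsupp.single J c) =
      Finsupp.single (J + Pi.single i 1) c + Finsupp.single J (𝒥.D i c) := by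
  simp [comp, Finsupp.mapDomain_single]

theorem app_comp (i : Fin n) (f : A) (a : (Fin n → ℕ) →₀ A) :
    𝒥.app f (𝒥.comp i a) = 𝒥.D i (𝒥.app f a) := by
  induction a using Finsupp.induction_linear with
  | zero => simp
  | add a b ha hb => simp only [map_add, ha, hb]
  | single J c =>
    rw [comp_single, map_add, app_single, app_single, app_single, DD_add_single,
      Derivation.leibniz]
    simp only [smul_eq_mul]; ring

/-- The adjoint of D_i ∘ a is -a^* ∘ D_i. With `app_comp` and `dU_D` this reduces statements about
D_J to one derivative at a time. -/
theorem adjApp_comp (i : Fin n) (f : A) (a : (Fin n → ℕ) →₀ A) :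
    𝒥.adjApp f (𝒥.comp i a) = -𝒥.adjApp (𝒥.D i f) a := by
  induction a using Finsupp.induction_linear with
  | zero => simp
  | add a b ha hb => simp only [map_add, ha, hb, neg_add]
  | single J c =>
    rw [comp_single, map_add, adjApp_single, adjApp_single, adjApp_single, DD_add_single,
      order_add_single, ← DD_D, Derivation.leibniz, map_add]
    simp only [smul_eq_mul, pow_succ, mul_neg, mul_one, neg_smul, smul_add, mul_comm f]
    abel

/-- The commutator of ∂/∂u_K with D_i is ∂/∂u_{K-i}, which supplies the index shift in `comp`. -/
theorem dU_D (i : Fin n) (f : A) : 𝒥.dU (𝒥.D i f) = 𝒥.comp i (𝒥.dU f) := by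
  classical
  ext K
  rw [dU_apply, U_D, comp, LinearMap.add_apply, Finsupp.add_apply, add_comm]
  congr 1
  obtain ⟨s, hs⟩ := 𝒥.exists_support f
  rw [𝒥.vert_eq_sum _ f hs, Finsupp.lmapDomain_apply, Finsupp.mapDomain,
    Finsupp.sum_of_support_subset (s := s), Finsupp.finsetSum_apply]
  · refine Finset.sum_congr rfl fun J _ => ?_
    simp [Finsupp.single_apply, eq_comm (a := K)]
  · intro J hJ
    by_contra h
    simp [hs J h] at hJ
  · simp

/-- The coefficients of the formal adjoint. -/
noncomputable def adj : ((Fin n → ℕ) →₀ A) →ₗ[ℝ] ((Fin n → ℕ) →₀ A) :=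
  Finsupp.lsum ℝ fun M => (-1 : ℝ) ^ order M •
    ∑ K ∈ Fintype.piFinset (fun i => Finset.range (M i + 1)),
      (∏ i, ((M i).choose (K i) : ℝ)) • (Finsupp.lsingle K ∘ₗ 𝒥.DD (M - K))

theorem adj_single_apply (M K : Fin n → ℕ) (c : A) :
    𝒥.adj (Finsupp.single M c) K =
      ((-1 : ℝ) ^ order M * ∏ i, ((M i).choose (K i) : ℝ)) • 𝒥.DD (M - K) c := by
  classical
  simp only [adj, Finsupp.lsum_single, LinearMap.smul_apply, LinearMap.sum_apply,
    LinearMap.comp_apply, Finsupp.lsingle_apply, Finsupp.smul_apply, Finsupp.finsetSum_apply,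
    Finsupp.single_apply, smul_ite, smul_zero, Finset.sum_ite_eq', mul_smul]
  split_ifs with h
  · rfl
  · simp only [Fintype.mem_piFinset, Finset.mem_range, not_forall, not_lt] at h
    obtain ⟨i, hi⟩ := h
    have : ∏ i, ((M i).choose (K i) : ℝ) = 0 :=
      Finset.prod_eq_zero (Finset.mem_univ i) (by
        rw [Nat.choose_eq_zero_of_lt (by omega), Nat.cast_zero])
    simp [this]

theorem adj_single_zero (c : A) : 𝒥.adj (Finsupp.single 0 c) = Finsupp.single 0 c := by
  classical
  ext K
  rw [adj_single_apply, Finsupp.single_apply]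
  by_cases hK : K = 0
  · subst hK
    simp [order]
  · rw [if_neg (Ne.symm hK)]
    obtain ⟨i, hi⟩ : ∃ i, K i ≠ 0 := by
      by_contra! h
      exact hK (funext h)
    have : ∏ i, (((0 : Fin n → ℕ) i).choose (K i) : ℝ) = 0 :=
      Finset.prod_eq_zero (Finset.mem_univ i) (by
        rw [Nat.choose_eq_zero_of_lt (by simpa using Nat.pos_of_ne_zero hi), Nat.cast_zero])
    rw [this, mul_zero, zero_smul]

/-- Pascal's rule: pushing one more D_i through the Leibniz expansion either raises the index K or
differentiates the coefficient. -/
theorem adj_single_add_single (M : Fin n → ℕ) (i : Fin n) (c : A) :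
    𝒥.adj (Finsupp.single (M + Pi.single i 1) c) = -𝒥.comp i (𝒥.adj (Finsupp.single M c)) := by
  classical
  have hinj : Function.Injective fun J : Fin n → ℕ => J + Pi.single i 1 :=
    fun J K h => add_right_cancel h
  have split : ∀ F : Fin n → ℕ, ∏ j, (F j : ℝ) = F i * ∏ j ∈ Finset.univ.erase i, (F j : ℝ) :=
    fun F => (Finset.mul_prod_erase _ _ (Finset.mem_univ i)).symm
  ext K
  simp only [comp, LinearMap.add_apply, Finsupp.neg_apply, Finsupp.add_apply,
    Finsupp.lmapDomain_apply, Finsupp.mapRange.linearMap_apply, Finsupp.mapRange_apply,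
    adj_single_apply, order_add_single]
  -- The shifted term needs a predecessor of K in direction i. Without one only the differentiated
  -- coefficient survives; otherwise both terms combine by Pascal's rule.
  by_cases hK : K i = 0
  · rw [Finsupp.mapDomain_of_notMem_range]
    · have h1 : M + Pi.single i 1 - K = (M - K) + Pi.single i 1 := by
        funext j
        by_cases hj : j = i
        · subst hj; simp [hK]
        · simp [hj]
      have h2 : ∏ j, (((M + Pi.single i 1 : Fin n → ℕ) j).choose (K j) : ℝ) =
          ∏ j, ((M j).choose (K j) : ℝ) := by
        refine Finset.prod_congr rfl fun j _ => ?_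
        by_cases hj : j = i
        · subst hj; simp [hK]
        · simp [hj]
      rw [h1, h2, DD_add_single]
      simp [pow_succ]
    · rintro ⟨J, rfl⟩
      simp at hK
  · obtain ⟨K, rfl⟩ : ∃ K', K = K' + Pi.single i 1 := ⟨K - Pi.single i 1, by
      funext j
      by_cases hj : j = i
      · subst hj; simp; omega
      · simp [hj]⟩
    rw [Finsupp.mapDomain_apply hinj, adj_single_apply]
    have h1 : M + Pi.single i 1 - (K + Pi.single i 1) = M - K := by
      exact add_tsub_add_eq_tsub_right _ _ _
    have hrest : ∏ j ∈ Finset.univ.erase i,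
        (((M + Pi.single i 1 : Fin n → ℕ) j).choose ((K + Pi.single i 1 : Fin n → ℕ) j) : ℝ) =
        ∏ j ∈ Finset.univ.erase i, ((M j).choose (K j) : ℝ) := by
      refine Finset.prod_congr rfl fun j hj => ?_
      simp [Finset.ne_of_mem_erase hj]
    have hrest' : ∏ j ∈ Finset.univ.erase i, ((M j).choose ((K + Pi.single i 1 : Fin n → ℕ) j) : ℝ) =
        ∏ j ∈ Finset.univ.erase i, ((M j).choose (K j) : ℝ) := by
      refine Finset.prod_congr rfl fun j hj => ?_
      simp [Finset.ne_of_mem_erase hj]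
    -- Truncated subtraction spoils the index identity exactly when M i ≤ K i, and there the
    -- binomial coefficient is zero.
    have h2 : ((M i).choose (K i + 1) : ℝ) • 𝒥.D i (𝒥.DD (M - (K + Pi.single i 1)) c) =
        ((M i).choose (K i + 1) : ℝ) • 𝒥.DD (M - K) c := by
      by_cases hlt : M i < K i + 1
      · simp [Nat.choose_eq_zero_of_lt hlt]
      · rw [← DD_add_single]
        congr 3
        funext j
        by_cases hj : j = i
        · subst hj; simp; omega
        · simp [hj]
    rw [h1, split (fun j => ((M + (Pi.single i 1 : Fin n → ℕ) : Fin n → ℕ) j).choose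
        ((K + (Pi.single i 1 : Fin n → ℕ) : Fin n → ℕ) j)),
      split (fun j => (M j).choose (K j)),
      split (fun j => (M j).choose ((K + (Pi.single i 1 : Fin n → ℕ) : Fin n → ℕ) j)),
      hrest, hrest', map_smul, Derivation.coeFn_coe]
    simp only [Pi.add_apply, Pi.single_eq_same, Nat.choose_succ_succ', Nat.cast_add]
    set p := ∏ j ∈ Finset.univ.erase i, ((M j).choose (K j) : ℝ)
    have h3 : ((-1 : ℝ) ^ order M * (((M i).choose (K i + 1) : ℝ) * p)) •
        𝒥.D i (𝒥.DD (M - (K + Pi.single i 1)) c) =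
        ((-1 : ℝ) ^ order M * (((M i).choose (K i + 1) : ℝ) * p)) • 𝒥.DD (M - K) c := by
      have : ((-1 : ℝ) ^ order M * (((M i).choose (K i + 1) : ℝ) * p)) =
        ((-1 : ℝ) ^ order M * p) * ((M i).choose (K i + 1) : ℝ) := by ring
      rw [this, mul_smul, mul_smul _ _ (𝒥.DD (M - K) c), h2]
    rw [h3, ← add_smul, ← neg_smul]
    congr 1
    rw [pow_succ]; ring

theorem app_adj (f : A) (a : (Fin n → ℕ) →₀ A) : 𝒥.app f (𝒥.adj a) = 𝒥.adjApp f a := by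
  induction a using Finsupp.induction_linear with
  | zero => simp
  | add a b ha hb => simp only [map_add, ha, hb]
  | single J c =>
    induction J using multiIndex_induction with
    | h0 => simp [adj_single_zero, order]
    | hs J i ih =>
      rw [adj_single_add_single, map_neg, app_comp, ih, adjApp_single, adjApp_single,
        DD_add_single, order_add_single, Derivation.map_smul, pow_succ]
      simp

theorem adjApp_adj (f : A) (a : (Fin n → ℕ) →₀ A) : 𝒥.adjApp f (𝒥.adj a) = 𝒥.app f a := by
  induction a using Finsupp.induction_linear with
  | zero => simp
  | add a b ha hb => simp only [map_add, ha, hb]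
  | single J c =>
    induction J using multiIndex_induction generalizing f with
    | h0 => simp [adj_single_zero, order]
    | hs J i ih =>
      rw [adj_single_add_single, map_neg, adjApp_comp, ih, app_single, app_single,
        DD_add_single, DD_D, neg_neg]

/-- The operators b are chosen before the argument a. This uniformity is needed for the homotopy,
where the coefficients of b are averaged. -/
theorem exists_integration_by_parts (c : (Fin n → ℕ) →₀ A) :
    ∃ b : Fin n → (Fin n → ℕ) →₀ A, ∀ a,
      𝒥.app a c - 𝒥.adjApp 1 c * a = ∑ i, 𝒥.D i (𝒥.app a (b i)) := by
  classical
  induction c using Finsupp.induction_linear with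
  | zero => exact ⟨0, by simp⟩
  | add c d hc hd =>
    obtain ⟨b, hb⟩ := hc
    obtain ⟨b', hb'⟩ := hd
    refine ⟨b + b', fun a => ?_⟩
    simp only [Pi.add_apply, map_add, Finset.sum_add_distrib, ← hb, ← hb']
    ring
  | single J c =>
    induction J using multiIndex_induction generalizing c with
    | h0 => exact ⟨0, by simp [order]⟩
    | hs J i ih =>
      -- One integration by parts: c D_i D_J a = D_i(c D_J a) - (D_i c) D_J a.
      obtain ⟨b, hb⟩ := ih (-𝒥.D i c)
      refine ⟨b + Pi.single i (Finsupp.single J c), fun a => ?_⟩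
      have h : ∑ j, 𝒥.D j (𝒥.app a ((Pi.single i (Finsupp.single J c) :
          Fin n → (Fin n → ℕ) →₀ A) j)) = 𝒥.D i (𝒥.app a (Finsupp.single J c)) := by
        rw [Finset.sum_eq_single i]
        · simp
        · intro j _ hj; simp [hj]
        · simp
      simp only [Pi.add_apply, map_add, Finset.sum_add_distrib, ← hb, h]
      simp only [app_single, adjApp_single, DD_add_single, order_add_single, Derivation.leibniz,
        smul_eq_mul, mul_one, ← DD_D, pow_succ, map_neg, smul_neg, neg_smul, mul_neg]
      ring

/-! ### The Euler operator, prolongations and the key identity -/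

/-- The Euler operator. -/
noncomputable def E (f : A) : A := 𝒥.adjApp 1 (𝒥.dU f)

theorem E_add (f g : A) : 𝒥.E (f + g) = 𝒥.E f + 𝒥.E g := by simp [E]

/-- By `adjApp_comp`, E(D_i B) is minus the adjoint of B' applied to D_i 1 = 0. -/
theorem E_sum_D (B : Fin n → A) : 𝒥.E (∑ i, 𝒥.D i (B i)) = 0 := by
  have : ∀ f, 𝒥.adjApp 0 f = 0 := fun f => by
    induction f using Finsupp.induction_linear with
    | zero => simp
    | add a b ha hb => simp only [map_add, ha, hb, add_zero]
    | single J c => simp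
  simp only [E, map_sum, dU_D, adjApp_comp, Derivation.map_one_eq_zero, this, neg_zero,
    Finset.sum_const_zero]

theorem adjApp_smul (f g : A) (a : (Fin n → ℕ) →₀ A) :
    𝒥.adjApp f (g • a) = 𝒥.adjApp (g * f) a := by
  induction a using Finsupp.induction_linear with
  | zero => simp
  | add a b ha hb => simp only [map_add, ha, hb, smul_add]
  | single J c =>
    rw [Finsupp.smul_single, adjApp_single, adjApp_single, smul_eq_mul]
    congr 2; ring

theorem app_smul (f g : A) (a : (Fin n → ℕ) →₀ A) :
    𝒥.app f (g • a) = g * 𝒥.app f a := by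
  induction a using Finsupp.induction_linear with
  | zero => simp
  | add a b ha hb => simp only [map_add, ha, hb, smul_add, mul_add]
  | single J c =>
    rw [Finsupp.smul_single, app_single, app_single, smul_eq_mul]
    ring

theorem E_app_mul (a : (Fin n → ℕ) →₀ A) (f g : A) :
    𝒥.E (g * 𝒥.app f a) = 𝒥.E (𝒥.adjApp g a * f) := by
  obtain ⟨b, hb⟩ := 𝒥.exists_integration_by_parts (g • a)
  have h := hb f
  rw [app_smul, adjApp_smul, mul_one, sub_eq_iff_eq_add] at h
  rw [h, E_add, E_sum_D, zero_add]

theorem dU_mul (f g : A) : 𝒥.dU (f * g) = f • 𝒥.dU g + g • 𝒥.dU f := by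
  ext J; simp

theorem E_mul (f g : A) : 𝒥.E (f * g) = 𝒥.adjApp f (𝒥.dU g) + 𝒥.adjApp g (𝒥.dU f) := by
  rw [E, dU_mul, map_add, adjApp_smul, adjApp_smul, mul_one, mul_one]

/-- The prolongation of `P ∂_u`. -/
noncomputable def pr (P : A) : Derivation ℝ A A := 𝒥.vert fun J => 𝒥.DD J P

theorem pr_apply (P f : A) : 𝒥.pr P f = 𝒥.app P (𝒥.dU f) := rfl

theorem pr_D (P : A) (i : Fin n) (f : A) : 𝒥.pr P (𝒥.D i f) = 𝒥.D i (𝒥.pr P f) := by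
  obtain ⟨s, hs⟩ := 𝒥.exists_support f
  rw [pr, D_vert, 𝒥.vert_eq_sum _ f hs]
  simp [DD_add_single]

theorem pr_DD (P : A) (J : Fin n → ℕ) (f : A) : 𝒥.pr P (𝒥.DD J f) = 𝒥.DD J (𝒥.pr P f) := by
  induction J using multiIndex_induction with
  | h0 => simp
  | hs J i ih => rw [DD_add_single, pr_D, ih, DD_add_single]

theorem adjApp_dU_DD (J : Fin n → ℕ) (f g : A) :
    𝒥.adjApp g (𝒥.dU (𝒥.DD J f)) = (-1 : ℝ) ^ order J • 𝒥.adjApp (𝒥.DD J g) (𝒥.dU f) := by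
  induction J using multiIndex_induction generalizing g with
  | h0 => simp [order]
  | hs J i ih =>
    rw [DD_add_single, dU_D, adjApp_comp, ih, order_add_single, DD_add_single, DD_D, pow_succ]
    simp

theorem adjApp_sum {ι : Type*} (s : Finset ι) (f : ι → A) (a : (Fin n → ℕ) →₀ A) :
    𝒥.adjApp (∑ i ∈ s, f i) a = ∑ i ∈ s, 𝒥.adjApp (f i) a := by
  induction a using Finsupp.induction_linear with
  | zero => simp
  | add a b ha hb => simp only [map_add, ha, hb, Finset.sum_add_distrib]
  | single J c => simp [Finset.mul_sum, Finset.smul_sum]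

theorem adjApp_smul_left (r : ℝ) (f : A) (a : (Fin n → ℕ) →₀ A) :
    𝒥.adjApp (r • f) a = r • 𝒥.adjApp f a := by
  induction a using Finsupp.induction_linear with
  | zero => simp
  | add a b ha hb => simp only [map_add, ha, hb, smul_add]
  | single J c => simp [smul_comm r]

/-- Apply the product rule for E to each term of ∑_J (∂f/∂u_J) D_J P. Differentiating D_J P yields
P'^*(E f) through `adjApp_dU_DD`; differentiating ∂f/∂u_J yields pr X_P(E f), since mixed
derivatives commute and pr X_P commutes with D_K. -/
theorem E_pr (P f : A) : 𝒥.E (𝒥.pr P f) = 𝒥.pr P (𝒥.E f) + 𝒥.adjApp (𝒥.E f) (𝒥.dU P) := by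
  obtain ⟨s, hs⟩ := 𝒥.exists_support f
  have hs' : ∀ K, ∀ J, J ∉ s → 𝒥.dU (𝒥.U K f) J = 0 := fun K J hJ => by
    rw [dU_apply, 𝒥.U_comm, hs J hJ, map_zero]
  have hE : 𝒥.E f = ∑ J ∈ s, (-1 : ℝ) ^ order J • 𝒥.DD J (𝒥.U J f) := by
    rw [E, 𝒥.adjApp_eq_sum 1 _ (s := s) (fun J hJ => by rw [dU_apply, hs J hJ])]
    simp
  have hsum : ∀ F : (Fin n → ℕ) → A, 𝒥.E (∑ J ∈ s, F J) = ∑ J ∈ s, 𝒥.E (F J) := fun F => by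
    simp [E, map_sum]
  rw [pr, 𝒥.vert_eq_sum _ f hs, hsum]
  simp only [E_mul, Finset.sum_add_distrib]
  rw [add_comm, ← pr]
  congr 1
  · rw [hE, map_sum]
    simp only [Derivation.map_smul, pr_DD, 𝒥.adjApp_eq_sum _ _ (hs' _), dU_apply]
    rw [Finset.sum_comm]
    refine Finset.sum_congr rfl fun J _ => ?_
    rw [pr, 𝒥.vert_eq_sum _ (𝒥.U J f) (s := s) fun K hK => by
      rw [𝒥.U_comm, hs K hK, map_zero], map_sum, Finset.smul_sum]
    refine Finset.sum_congr rfl fun K _ => ?_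
    rw [𝒥.U_comm]
  · rw [hE, adjApp_sum]
    refine Finset.sum_congr rfl fun J _ => ?_
    rw [adjApp_dU_DD, adjApp_smul_left]

theorem E_pr_eq (P f : A) : 𝒥.E (𝒥.pr P f) = 𝒥.E (𝒥.E f * P) := by
  have := 𝒥.E_app_mul (𝒥.dU f) P 1
  rwa [one_mul] at this

/-- The Frechet derivative of an Euler-Lagrange expression is formally self-adjoint. -/
theorem adjApp_dU_E (f P : A) : 𝒥.adjApp P (𝒥.dU (𝒥.E f)) = 𝒥.pr P (𝒥.E f) := by
  have h := 𝒥.E_pr P f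
  rw [E_pr_eq, E_mul, add_comm] at h
  exact add_right_cancel h

/-- `pr X_P` acting on the coefficients of an operator. -/
noncomputable def prOp (P : A) : ((Fin n → ℕ) →₀ A) →ₗ[ℝ] ((Fin n → ℕ) →₀ A) :=
  Finsupp.mapRange.linearMap (𝒥.pr P : A →ₗ[ℝ] A)

/-- The Leibniz rule for a prolongation acting on an operator applied to a function; it produces the
term (pr X_P S^*) G. -/
theorem pr_app (P f : A) (a : (Fin n → ℕ) →₀ A) :
    𝒥.pr P (𝒥.app f a) = 𝒥.app f (𝒥.prOp P a) + 𝒥.app (𝒥.pr P f) a := by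
  induction a using Finsupp.induction_linear with
  | zero => simp
  | add a b ha hb => simp only [map_add, ha, hb]; abel
  | single J c =>
    simp [prOp, pr_DD]; ring

/-- The obstruction to S(P) being variational is exactly the difference of the two sides of the
criterion. -/
theorem E_pr_recursion (L Q P : A) (R : (Fin n → ℕ) →₀ A)
    (hQ : 𝒥.app Q (𝒥.dU (𝒥.E L)) = 𝒥.app (𝒥.E L) R) (hP : 𝒥.E (𝒥.pr P L) = 0) :
    𝒥.E (𝒥.pr (𝒥.app P (𝒥.adj R + 𝒥.dU Q)) L) =
      𝒥.app (𝒥.E L) (𝒥.prOp P (𝒥.adj (𝒥.adj R + 𝒥.dU Q))) -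
      (𝒥.app (𝒥.app (𝒥.E L) (𝒥.adj (𝒥.dU P))) (𝒥.adj (𝒥.adj R + 𝒥.dU Q)) -
        𝒥.app (𝒥.app (𝒥.E L) (𝒥.adj (𝒥.adj R + 𝒥.dU Q))) (𝒥.adj (𝒥.dU P))) := by
  set G := 𝒥.E L with hG
  set S := 𝒥.adj R + 𝒥.dU Q with hS
  set M := 𝒥.app G (𝒥.adj S) with hM
  -- R^{**} = R turns S^* G into R(G) + Q'^* G = G'(Q) + Q'^* G, which `E_pr` identifies as an
  -- Euler-Lagrange expression.
  have hM1 : M = 𝒥.E (𝒥.pr Q L) := by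
    rw [hM, app_adj, hS, map_add, adjApp_adj, ← hQ, ← pr_apply, E_pr]
  have hM2 : 𝒥.adjApp P (𝒥.dU M) = 𝒥.pr P M := by rw [hM1, adjApp_dU_E]
  have hprG : 𝒥.pr P G = -𝒥.app G (𝒥.adj (𝒥.dU P)) := by
    rw [E_pr, ← hG] at hP
    rw [app_adj]; exact eq_neg_of_add_eq_zero_left hP
  have hneg : 𝒥.app (-𝒥.app G (𝒥.adj (𝒥.dU P))) (𝒥.adj S) =
      -𝒥.app (𝒥.app G (𝒥.adj (𝒥.dU P))) (𝒥.adj S) := by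
    generalize 𝒥.app G (𝒥.adj (𝒥.dU P)) = x
    rw [app_adj, app_adj, ← neg_one_smul ℝ, adjApp_smul_left, neg_one_smul]
  rw [E_pr_eq, E_app_mul, ← app_adj, ← hM, E_mul, hM2, ← app_adj, hM, pr_app, hprG, hneg]
  ring

end JetAlgebra

end JetCalculus

/-! ### Differential functions on open subsets of jet space -/

namespace JetCalculus

variable {n : ℕ}

/-- Openness of the image of Ω lets `ContDiffOn` there yield genuine derivatives of local
representatives. -/
theorem isOpenMap_proj (s : Finset (Fin n → ℕ)) : IsOpenMap (proj (n := n) s) := by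
  classical
  intro Ω hΩ
  rw [isOpen_iff_mem_nhds]
  rintro _ ⟨z, hz, rfl⟩
  -- A continuous section of the projection through z, with all coordinates outside s frozen at
  -- their values in z.
  let σ : (Fin n → ℝ) × (s → ℝ) → Jet n := fun y =>
    (y.1, fun J => if h : J ∈ s then y.2 ⟨J, h⟩ else z.2 J)
  have hσ : Continuous σ := by
    refine continuous_fst.prodMk (continuous_pi fun J => ?_)
    by_cases h : J ∈ s
    · simp only [h, dif_pos]; fun_prop
    · simp only [h, dif_neg, not_false_eq_true]; fun_prop
  have h1 : σ (proj s z) = z := by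
    refine Prod.ext rfl (funext fun J => ?_)
    by_cases h : J ∈ s <;> simp [σ, proj, h]
  have h2 : ∀ y, proj s (σ y) = y := fun y =>
    Prod.ext rfl (funext fun J => by simp [σ, proj])
  refine Filter.mem_of_superset
    ((hΩ.preimage hσ).mem_nhds (show σ (proj s z) ∈ Ω by rwa [h1])) fun y hy => ?_
  exact ⟨σ y, hy, h2 y⟩

theorem isOpen_proj_image {Ω : Set (Jet n)} (hΩ : IsOpen Ω) (s : Finset (Fin n → ℕ)) :
    IsOpen (proj s '' Ω) := isOpenMap_proj s Ω hΩ

theorem IsDiffFun.congr {Ω : Set (Jet n)} {f g : Jet n → ℝ} (hf : IsDiffFun Ω f)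
    (h : ∀ z ∈ Ω, g z = f z) : IsDiffFun Ω g := by
  obtain ⟨s, F, hF, hf⟩ := hf
  exact ⟨s, F, hF, fun z hz => (h z hz).trans (hf z hz)⟩

theorem IsDiffFun.mono {Ω V : Set (Jet n)} {f : Jet n → ℝ} (hf : IsDiffFun Ω f)
    (h : V ⊆ Ω) : IsDiffFun V f := by
  obtain ⟨s, F, hF, hf⟩ := hf
  exact ⟨s, F, hF.mono (Set.image_mono h), fun z hz => hf z (h hz)⟩

theorem IsDiffFun.exists_superset {Ω : Set (Jet n)} {f : Jet n → ℝ} (hf : IsDiffFun Ω f) :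
    ∃ s : Finset (Fin n → ℕ), ∀ t, s ⊆ t → ∃ g : (Fin n → ℝ) × (t → ℝ) → ℝ,
      ContDiffOn ℝ ∞ g (proj t '' Ω) ∧ ∀ z ∈ Ω, f z = g (proj t z) := by
  obtain ⟨s, g, hg, hf⟩ := hf
  refine ⟨s, fun t hst => ⟨fun y => g (y.1, fun J => y.2 ⟨J, hst J.2⟩), ?_, fun z hz => hf z hz⟩⟩
  refine hg.comp (ContDiff.contDiffOn ?_) ?_
  · fun_prop
  · rintro _ ⟨z, hz, rfl⟩
    exact ⟨z, hz, rfl⟩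

theorem isDiffFun_const (Ω : Set (Jet n)) (c : ℝ) : IsDiffFun Ω fun _ => c :=
  ⟨∅, fun _ => c, contDiffOn_const, fun _ _ => rfl⟩

theorem isDiffFun_coord (Ω : Set (Jet n)) (J : Fin n → ℕ) : IsDiffFun Ω fun z => z.2 J :=
  ⟨{J}, fun y => y.2 ⟨J, by simp⟩, by fun_prop, fun _ _ => rfl⟩

theorem IsDiffFun.exists_common {Ω : Set (Jet n)} {f g : Jet n → ℝ} (hf : IsDiffFun Ω f)
    (hg : IsDiffFun Ω g) : ∃ (s : Finset (Fin n → ℕ)) (F G : (Fin n → ℝ) × (s → ℝ) → ℝ),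
      ContDiffOn ℝ ∞ F (proj s '' Ω) ∧ ContDiffOn ℝ ∞ G (proj s '' Ω) ∧
      (∀ z ∈ Ω, f z = F (proj s z)) ∧ ∀ z ∈ Ω, g z = G (proj s z) := by
  classical
  obtain ⟨s, hs⟩ := hf.exists_superset
  obtain ⟨t, ht⟩ := hg.exists_superset
  obtain ⟨F, hF, hf⟩ := hs (s ∪ t) Finset.subset_union_left
  obtain ⟨G, hG, hg⟩ := ht (s ∪ t) Finset.subset_union_right
  exact ⟨s ∪ t, F, G, hF, hG, hf, hg⟩

theorem IsDiffFun.add {Ω : Set (Jet n)} {f g : Jet n → ℝ} (hf : IsDiffFun Ω f)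
    (hg : IsDiffFun Ω g) : IsDiffFun Ω (f + g) := by
  obtain ⟨s, F, G, hF, hG, hf, hg⟩ := hf.exists_common hg
  exact ⟨s, F + G, hF.add hG, fun z hz => by simp [hf z hz, hg z hz]⟩

theorem IsDiffFun.mul {Ω : Set (Jet n)} {f g : Jet n → ℝ} (hf : IsDiffFun Ω f)
    (hg : IsDiffFun Ω g) : IsDiffFun Ω (f * g) := by
  obtain ⟨s, F, G, hF, hG, hf, hg⟩ := hf.exists_common hg
  exact ⟨s, F * G, hF.mul hG, fun z hz => by simp [hf z hz, hg z hz]⟩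

/-- Off Ω the values of f are arbitrary, so the chain rule is applied to the representative g and
transferred by eventual equality along the curve. -/
theorem hasDerivAt_comp_curve {Ω : Set (Jet n)} (hΩ : IsOpen Ω) {f : Jet n → ℝ}
    {s : Finset (Fin n → ℕ)} {g : (Fin n → ℝ) × (s → ℝ) → ℝ}
    (hg : ContDiffOn ℝ ∞ g (proj s '' Ω)) (hf : ∀ z ∈ Ω, f z = g (proj s z))
    {γ : ℝ → Jet n} {t : ℝ} (hγ : ContinuousAt γ t) (ht : γ t ∈ Ω)
    {v : (Fin n → ℝ) × (s → ℝ)} (hv : HasDerivAt (fun r => proj s (γ r)) v t) :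
    HasDerivAt (fun r => f (γ r)) (fderiv ℝ g (proj s (γ t)) v) t := by
  have hmem : proj s (γ t) ∈ proj s '' Ω := ⟨_, ht, rfl⟩
  have hd : DifferentiableAt ℝ g (proj s (γ t)) :=
    (hg.differentiableOn (by simp)).differentiableAt
      ((isOpen_proj_image hΩ s).mem_nhds hmem)
  have := hd.hasFDerivAt.comp_hasDerivAt t hv
  refine this.congr_of_eventuallyEq ?_
  filter_upwards [hγ.preimage_mem_nhds (hΩ.mem_nhds ht)] with r hr
  exact hf _ hr

theorem continuous_update_fst (z : Jet n) (i : Fin n) :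
    Continuous fun t : ℝ => ((Function.update z.1 i t, z.2) : Jet n) :=
  by fun_prop

theorem continuous_update_snd (z : Jet n) (J : Fin n → ℕ) :
    Continuous fun t : ℝ => ((z.1, Function.update z.2 J t) : Jet n) :=
  by fun_prop

theorem hasDerivAt_proj_update_fst (s : Finset (Fin n → ℕ)) (z : Jet n) (i : Fin n) (t : ℝ) :
    HasDerivAt (fun r : ℝ => proj s (Function.update z.1 i r, z.2))
      (proj s (Pi.single i 1, 0)) t := by
  refine HasDerivAt.prodMk (hasDerivAt_pi.2 fun j => ?_) (hasDerivAt_const t fun J : s => z.2 J)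
  by_cases h : j = i
  · subst h; simpa using hasDerivAt_id' t
  · simpa [h] using hasDerivAt_const t (z.1 j)

theorem hasDerivAt_proj_update_snd (s : Finset (Fin n → ℕ)) (z : Jet n) (J : Fin n → ℕ) (t : ℝ) :
    HasDerivAt (fun r : ℝ => proj s (z.1, Function.update z.2 J r))
      (proj s (0, Pi.single J 1)) t := by
  refine HasDerivAt.prodMk (hasDerivAt_const _ _) (hasDerivAt_pi.2 fun K => ?_)
  by_cases h : (K : Fin n → ℕ) = J
  · subst h; simpa using hasDerivAt_id' t
  · simpa [h] using hasDerivAt_const t (z.2 K)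

section

variable {Ω : Set (Jet n)} {f : Jet n → ℝ}

theorem hasDerivAt_partialX {s : Finset (Fin n → ℕ)} {g : (Fin n → ℝ) × (s → ℝ) → ℝ}
    (hΩ : IsOpen Ω) (hg : ContDiffOn ℝ ∞ g (proj s '' Ω)) (hf : ∀ z ∈ Ω, f z = g (proj s z))
    (i : Fin n) {z : Jet n} (hz : z ∈ Ω) :
    HasDerivAt (fun t : ℝ => f (Function.update z.1 i t, z.2))
      (fderiv ℝ g (proj s z) (proj s (Pi.single i 1, 0))) (z.1 i) := by
  have hz' : ((Function.update z.1 i (z.1 i), z.2) : Jet n) = z := by simp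
  have := hasDerivAt_comp_curve hΩ hg hf (t := z.1 i) (continuous_update_fst z i).continuousAt
    (by rwa [hz']) (hasDerivAt_proj_update_fst s z i _)
  rwa [hz'] at this

theorem hasDerivAt_partialU {s : Finset (Fin n → ℕ)} {g : (Fin n → ℝ) × (s → ℝ) → ℝ}
    (hΩ : IsOpen Ω) (hg : ContDiffOn ℝ ∞ g (proj s '' Ω)) (hf : ∀ z ∈ Ω, f z = g (proj s z))
    (J : Fin n → ℕ) {z : Jet n} (hz : z ∈ Ω) :
    HasDerivAt (fun t : ℝ => f (z.1, Function.update z.2 J t))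
      (fderiv ℝ g (proj s z) (proj s (0, Pi.single J 1))) (z.2 J) := by
  have hz' : ((z.1, Function.update z.2 J (z.2 J)) : Jet n) = z := by simp
  have := hasDerivAt_comp_curve hΩ hg hf (t := z.2 J) (continuous_update_snd z J).continuousAt
    (by rwa [hz']) (hasDerivAt_proj_update_snd s z J _)
  rwa [hz'] at this

theorem contDiffOn_fderiv_apply {s : Finset (Fin n → ℕ)} {g : (Fin n → ℝ) × (s → ℝ) → ℝ}
    (hΩ : IsOpen Ω) (hg : ContDiffOn ℝ ∞ g (proj s '' Ω)) (v : (Fin n → ℝ) × (s → ℝ)) :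
    ContDiffOn ℝ ∞ (fun y => fderiv ℝ g y v) (proj s '' Ω) :=
  (hg.fderiv_of_isOpen (isOpen_proj_image hΩ s) (m := ∞) (by simp)).clm_apply contDiffOn_const

theorem fderiv_fderiv_comm {s : Finset (Fin n → ℕ)} {g : (Fin n → ℝ) × (s → ℝ) → ℝ}
    (hΩ : IsOpen Ω) (hg : ContDiffOn ℝ ∞ g (proj s '' Ω)) (v w : (Fin n → ℝ) × (s → ℝ))
    {z : Jet n} (hz : z ∈ Ω) :
    fderiv ℝ (fun y => fderiv ℝ g y v) (proj s z) w =
      fderiv ℝ (fun y => fderiv ℝ g y w) (proj s z) v := by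
  have hmem : proj s '' Ω ∈ nhds (proj s z) :=
    (isOpen_proj_image hΩ s).mem_nhds ⟨z, hz, rfl⟩
  have hs : IsSymmSndFDerivAt ℝ g (proj s z) :=
    (hg.contDiffAt hmem).isSymmSndFDerivAt (by simpa using (WithTop.coe_le_coe.2 le_top : ((2 : ℕ∞) : WithTop ℕ∞) ≤ ∞))
  have hd : DifferentiableAt ℝ (fderiv ℝ g) (proj s z) :=
    ((hg.fderiv_of_isOpen (isOpen_proj_image hΩ s) (m := ∞) (by simp)).differentiableOn
      (by simp)).differentiableAt hmem
  rw [fderiv_clm_apply hd (by fun_prop), fderiv_clm_apply hd (by fun_prop)]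
  simpa using hs.eq w v

theorem partialX_congr (hΩ : IsOpen Ω) {f g : Jet n → ℝ} (h : ∀ z ∈ Ω, f z = g z) (i : Fin n)
    {z : Jet n} (hz : z ∈ Ω) : partialX i f z = partialX i g z := by
  refine Filter.EventuallyEq.deriv_eq ?_
  have hz' : ((Function.update z.1 i (z.1 i), z.2) : Jet n) = z := by simp
  filter_upwards [(continuous_update_fst z i).continuousAt.preimage_mem_nhds
    (hΩ.mem_nhds (by rwa [hz']))] with r hr
  exact h _ hr

theorem partialU_congr (hΩ : IsOpen Ω) {f g : Jet n → ℝ} (h : ∀ z ∈ Ω, f z = g z)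
    (J : Fin n → ℕ) {z : Jet n} (hz : z ∈ Ω) : partialU J f z = partialU J g z := by
  refine Filter.EventuallyEq.deriv_eq ?_
  have hz' : ((z.1, Function.update z.2 J (z.2 J)) : Jet n) = z := by simp
  filter_upwards [(continuous_update_snd z J).continuousAt.preimage_mem_nhds
    (hΩ.mem_nhds (by rwa [hz']))] with r hr
  exact h _ hr

end

/-! ### The jet algebra of differential functions on Ω -/

/-- The algebra of differential functions on `Ω`. -/
def diffAlg (Ω : Set (Jet n)) : Subalgebra ℝ (Ω → ℝ) where
  carrier := {f | ∃ F : Jet n → ℝ, IsDiffFun Ω F ∧ ∀ z : Ω, F z = f z}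
  mul_mem' := by
    rintro f g ⟨F, hF, hf⟩ ⟨G, hG, hg⟩
    exact ⟨F * G, hF.mul hG, fun z => by simp [hf, hg]⟩
  add_mem' := by
    rintro f g ⟨F, hF, hf⟩ ⟨G, hG, hg⟩
    exact ⟨F + G, hF.add hG, fun z => by simp [hf, hg]⟩
  algebraMap_mem' c := ⟨fun _ => c, isDiffFun_const Ω c, fun _ => rfl⟩

/-- `F` restricts to the element `f` of the algebra of differential functions on `Ω`. -/
def Rep {Ω : Set (Jet n)} (F : Jet n → ℝ) (f : diffAlg Ω) : Prop := ∀ z : Ω, F z = f.1 z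

/-- The restriction of a differential function to `Ω`. -/
def restr {Ω : Set (Jet n)} {F : Jet n → ℝ} (hF : IsDiffFun Ω F) : diffAlg Ω :=
  ⟨fun z => F z, F, hF, fun _ => rfl⟩

theorem rep_restr {Ω : Set (Jet n)} {F : Jet n → ℝ} (hF : IsDiffFun Ω F) : Rep F (restr hF) :=
  fun _ => rfl

/-- Some function on jet space that restricts to the given element. -/
noncomputable def extend {Ω : Set (Jet n)} (f : diffAlg Ω) : Jet n → ℝ := f.2.choose

theorem isDiffFun_extend {Ω : Set (Jet n)} (f : diffAlg Ω) : IsDiffFun Ω (extend f) :=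
  f.2.choose_spec.1

theorem rep_extend {Ω : Set (Jet n)} (f : diffAlg Ω) : Rep (extend f) f := f.2.choose_spec.2

theorem Rep.eq {Ω : Set (Jet n)} {F : Jet n → ℝ} {f g : diffAlg Ω} (hf : Rep F f)
    (hg : Rep F g) : f = g := Subtype.ext (funext fun z => (hf z).symm.trans (hg z))

theorem Rep.congr {Ω : Set (Jet n)} {F G : Jet n → ℝ} {f : diffAlg Ω} (hf : Rep F f)
    (h : ∀ z ∈ Ω, G z = F z) : Rep G f := fun z => (h z z.2).trans (hf z)

theorem Rep.isDiffFun {Ω : Set (Jet n)} {F : Jet n → ℝ} {f : diffAlg Ω} (hf : Rep F f) :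
    IsDiffFun Ω F :=
  (isDiffFun_extend f).congr fun z hz => (hf ⟨z, hz⟩).trans (rep_extend f ⟨z, hz⟩).symm

theorem Rep.add {Ω : Set (Jet n)} {F G : Jet n → ℝ} {f g : diffAlg Ω} (hf : Rep F f)
    (hg : Rep G g) : Rep (F + G) (f + g) := fun z => by simp [hf z, hg z]

theorem Rep.mul {Ω : Set (Jet n)} {F G : Jet n → ℝ} {f g : diffAlg Ω} (hf : Rep F f)
    (hg : Rep G g) : Rep (F * G) (f * g) := fun z => by simp [hf z, hg z]

theorem IsDiffFun.partialX {Ω : Set (Jet n)} (hΩ : IsOpen Ω) {f : Jet n → ℝ}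
    (hf : IsDiffFun Ω f) (i : Fin n) : IsDiffFun Ω (partialX i f) := by
  obtain ⟨s, g, hg, hf⟩ := hf
  exact ⟨s, _, contDiffOn_fderiv_apply hΩ hg _,
    fun z hz => (hasDerivAt_partialX hΩ hg hf i hz).deriv⟩

theorem IsDiffFun.partialU {Ω : Set (Jet n)} (hΩ : IsOpen Ω) {f : Jet n → ℝ}
    (hf : IsDiffFun Ω f) (J : Fin n → ℕ) : IsDiffFun Ω (partialU J f) := by
  obtain ⟨s, g, hg, hf⟩ := hf
  exact ⟨s, _, contDiffOn_fderiv_apply hΩ hg _,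
    fun z hz => (hasDerivAt_partialU hΩ hg hf J hz).deriv⟩

theorem IsDiffFun.differentiableAt_fst {Ω : Set (Jet n)} (hΩ : IsOpen Ω) {f : Jet n → ℝ}
    (hf : IsDiffFun Ω f) (i : Fin n) {z : Jet n} (hz : z ∈ Ω) :
    DifferentiableAt ℝ (fun t : ℝ => f (Function.update z.1 i t, z.2)) (z.1 i) := by
  obtain ⟨s, g, hg, hf⟩ := hf
  exact (hasDerivAt_partialX hΩ hg hf i hz).differentiableAt

theorem IsDiffFun.differentiableAt_snd {Ω : Set (Jet n)} (hΩ : IsOpen Ω) {f : Jet n → ℝ}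
    (hf : IsDiffFun Ω f) (J : Fin n → ℕ) {z : Jet n} (hz : z ∈ Ω) :
    DifferentiableAt ℝ (fun t : ℝ => f (z.1, Function.update z.2 J t)) (z.2 J) := by
  obtain ⟨s, g, hg, hf⟩ := hf
  exact (hasDerivAt_partialU hΩ hg hf J hz).differentiableAt

/-- The derivation of the algebra of differential functions induced by a local operator that
satisfies the Leibniz rule. -/
noncomputable def inducedDerivation {Ω : Set (Jet n)} (T : (Jet n → ℝ) → Jet n → ℝ)
    (hT : ∀ F, IsDiffFun Ω F → IsDiffFun Ω (T F))
    (hcongr : ∀ F G, (∀ z ∈ Ω, F z = G z) → ∀ z ∈ Ω, T F z = T G z)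
    (hadd : ∀ F G, IsDiffFun Ω F → IsDiffFun Ω G → ∀ z ∈ Ω, T (F + G) z = T F z + T G z)
    (hmul : ∀ F G, IsDiffFun Ω F → IsDiffFun Ω G →
      ∀ z ∈ Ω, T (F * G) z = F z * T G z + G z * T F z)
    (hconst : ∀ c : ℝ, ∀ z ∈ Ω, T (fun _ => c) z = 0) : Derivation ℝ (diffAlg Ω) (diffAlg Ω) :=
  have hadd' : ∀ f g : diffAlg Ω, restr (hT _ (isDiffFun_extend (f + g))) =
      restr (hT _ (isDiffFun_extend f)) + restr (hT _ (isDiffFun_extend g)) := fun f g => by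
    refine (rep_restr _).eq (((rep_restr _).add (rep_restr _)).congr fun z hz => ?_)
    rw [hcongr _ _ (fun z hz => ?_) z hz]
    · exact hadd _ _ (isDiffFun_extend f) (isDiffFun_extend g) z hz
    · exact (rep_extend (f + g) ⟨z, hz⟩).trans (((rep_extend f).add (rep_extend g)) ⟨z, hz⟩).symm
  have hmul' : ∀ f g : diffAlg Ω, restr (hT _ (isDiffFun_extend (f * g))) =
      f * restr (hT _ (isDiffFun_extend g)) + g * restr (hT _ (isDiffFun_extend f)) :=
    fun f g => by
    refine (rep_restr _).eq ((((rep_extend f).mul (rep_restr (hT _ (isDiffFun_extend g)))).add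
      ((rep_extend g).mul (rep_restr (hT _ (isDiffFun_extend f))))).congr fun z hz => ?_)
    rw [hcongr _ _ (fun z hz => ?_) z hz]
    · exact hmul _ _ (isDiffFun_extend f) (isDiffFun_extend g) z hz
    · exact (rep_extend (f * g) ⟨z, hz⟩).trans (((rep_extend f).mul (rep_extend g)) ⟨z, hz⟩).symm
  have hconst' : ∀ c : ℝ, restr (hT _ (isDiffFun_extend (algebraMap ℝ (diffAlg Ω) c))) = 0 :=
    fun c => by
    refine (rep_restr _).eq fun z => ?_
    rw [hcongr _ (fun _ => c) (fun z hz => rep_extend _ ⟨z, hz⟩) z z.2, hconst c z z.2]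
    rfl
  Derivation.mk'
    { toFun := fun f => restr (hT _ (isDiffFun_extend f))
      map_add' := hadd'
      map_smul' := fun c f => by
        rw [Algebra.smul_def, hmul', hconst', mul_zero, add_zero, RingHom.id_apply,
          Algebra.smul_def] }
    fun f g => hmul' f g

theorem rep_inducedDerivation {Ω : Set (Jet n)} {T : (Jet n → ℝ) → Jet n → ℝ} {hT}
    (hcongr : ∀ F G, (∀ z ∈ Ω, F z = G z) → ∀ z ∈ Ω, T F z = T G z) {hadd hmul hconst}
    {F : Jet n → ℝ} {f : diffAlg Ω} (hF : Rep F f) :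
    Rep (T F) (inducedDerivation T hT hcongr hadd hmul hconst f) := by
  refine Rep.congr (rep_restr (hT _ (isDiffFun_extend f))) fun z hz => ?_
  exact hcongr _ _ (fun z hz => (hF ⟨z, hz⟩).trans (rep_extend f ⟨z, hz⟩).symm) z hz

/-- `∂/∂x^i` as a derivation. -/
noncomputable def derivX {Ω : Set (Jet n)} (hΩ : IsOpen Ω) (i : Fin n) :
    Derivation ℝ (diffAlg Ω) (diffAlg Ω) :=
  inducedDerivation (partialX i) (fun _ hF => hF.partialX hΩ i)
    (fun _ _ h _ hz => partialX_congr hΩ h i hz)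
    (fun _ _ hF hG _ hz =>
      deriv_fun_add (hF.differentiableAt_fst hΩ i hz) (hG.differentiableAt_fst hΩ i hz))
    (fun F G hF hG z hz => by
      have := deriv_fun_mul (hF.differentiableAt_fst hΩ i hz) (hG.differentiableAt_fst hΩ i hz)
      simp only [Function.update_eq_self, Prod.mk.eta] at this
      simp only [partialX, Pi.mul_apply, this]
      ring)
    (fun c z _ => deriv_const _ _)

/-- `∂/∂u_J` as a derivation. -/
noncomputable def derivU {Ω : Set (Jet n)} (hΩ : IsOpen Ω) (J : Fin n → ℕ) :
    Derivation ℝ (diffAlg Ω) (diffAlg Ω) :=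
  inducedDerivation (partialU J) (fun _ hF => hF.partialU hΩ J)
    (fun _ _ h _ hz => partialU_congr hΩ h J hz)
    (fun _ _ hF hG _ hz =>
      deriv_fun_add (hF.differentiableAt_snd hΩ J hz) (hG.differentiableAt_snd hΩ J hz))
    (fun F G hF hG z hz => by
      have := deriv_fun_mul (hF.differentiableAt_snd hΩ J hz) (hG.differentiableAt_snd hΩ J hz)
      simp only [Function.update_eq_self, Prod.mk.eta] at this
      simp only [partialU, Pi.mul_apply, this]
      ring)
    (fun c z _ => deriv_const _ _)

theorem rep_derivX {Ω : Set (Jet n)} (hΩ : IsOpen Ω) (i : Fin n) {F : Jet n → ℝ}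
    {f : diffAlg Ω} (hF : Rep F f) : Rep (partialX i F) (derivX hΩ i f) :=
  rep_inducedDerivation _ hF

theorem rep_derivU {Ω : Set (Jet n)} (hΩ : IsOpen Ω) (J : Fin n → ℕ) {F : Jet n → ℝ}
    {f : diffAlg Ω} (hF : Rep F f) : Rep (partialU J F) (derivU hΩ J f) :=
  rep_inducedDerivation _ hF

/-- The algebra of differential functions on an open set is a jet algebra. -/
noncomputable def jetAlgebra {Ω : Set (Jet n)} (hΩ : IsOpen Ω) : JetAlgebra n (diffAlg Ω) where
  X := derivX hΩ
  U := derivU hΩ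
  u J := restr (isDiffFun_coord Ω J)
  X_comm i j f := by
    obtain ⟨s, g, hg, hf⟩ := isDiffFun_extend f
    refine (rep_derivX hΩ i (rep_derivX hΩ j (rep_extend f))).eq
      ((rep_derivX hΩ j (rep_derivX hΩ i (rep_extend f))).congr fun z hz => ?_)
    have h := fun i z hz => (hasDerivAt_partialX hΩ hg hf i (z := z) hz).deriv
    exact (hasDerivAt_partialX hΩ (contDiffOn_fderiv_apply hΩ hg _) (h j) i hz).deriv.trans
      ((fderiv_fderiv_comm hΩ hg _ _ hz).trans
        (hasDerivAt_partialX hΩ (contDiffOn_fderiv_apply hΩ hg _) (h i) j hz).deriv.symm)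
  U_comm J K f := by
    obtain ⟨s, g, hg, hf⟩ := isDiffFun_extend f
    refine (rep_derivU hΩ J (rep_derivU hΩ K (rep_extend f))).eq
      ((rep_derivU hΩ K (rep_derivU hΩ J (rep_extend f))).congr fun z hz => ?_)
    have h := fun J z hz => (hasDerivAt_partialU hΩ hg hf J (z := z) hz).deriv
    exact (hasDerivAt_partialU hΩ (contDiffOn_fderiv_apply hΩ hg _) (h K) J hz).deriv.trans
      ((fderiv_fderiv_comm hΩ hg _ _ hz).trans
        (hasDerivAt_partialU hΩ (contDiffOn_fderiv_apply hΩ hg _) (h J) K hz).deriv.symm)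
  XU_comm i J f := by
    obtain ⟨s, g, hg, hf⟩ := isDiffFun_extend f
    refine (rep_derivX hΩ i (rep_derivU hΩ J (rep_extend f))).eq
      ((rep_derivU hΩ J (rep_derivX hΩ i (rep_extend f))).congr fun z hz => ?_)
    have hx := fun z hz => (hasDerivAt_partialX hΩ hg hf i (z := z) hz).deriv
    have hu := fun z hz => (hasDerivAt_partialU hΩ hg hf J (z := z) hz).deriv
    exact (hasDerivAt_partialX hΩ (contDiffOn_fderiv_apply hΩ hg _) hu i hz).deriv.trans
      ((fderiv_fderiv_comm hΩ hg _ _ hz).trans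
        (hasDerivAt_partialU hΩ (contDiffOn_fderiv_apply hΩ hg _) hx J hz).deriv.symm)
  U_u J K := by
    refine (rep_derivU hΩ J (rep_restr (isDiffFun_coord Ω K))).eq fun z => ?_
    by_cases h : J = K
    · subst h; simp [partialU]
    · simp [partialU, h, Function.update_of_ne (Ne.symm h)]
  X_u i J := by
    refine (rep_derivX hΩ i (rep_restr (isDiffFun_coord Ω J))).eq fun z => ?_
    simp [partialX]
  finite f := by
    obtain ⟨s, g, hg, hf⟩ := isDiffFun_extend f
    refine s.finite_toSet.subset fun J hJ => ?_
    by_contra hJs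
    apply hJ
    refine (rep_derivU hΩ J (rep_extend f)).eq fun z => ?_
    rw [partialU, (hasDerivAt_partialU hΩ hg hf J z.2).deriv]
    -- The direction u_J is invisible to a representative that uses only the coordinates in s.
    have : proj s ((0, Pi.single J 1) : Jet n) = 0 := by
      refine Prod.ext rfl (funext fun K => ?_)
      have : (K : Fin n → ℕ) ≠ J := fun h => hJs (h ▸ K.2)
      simp [proj, this]
    rw [this, map_zero]
    rfl

end JetCalculus

/-! ### Transfer between jet space and the jet algebra -/

namespace JetCalculus

variable {n : ℕ}

/-- Reindexing M = K + J matches the algebraic adjoint with the coefficient formula of `Op.adj`;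
indices M not above K contribute zero binomials. -/
theorem JetAlgebra.adj_apply_eq_finsum {A : Type*} [CommRing A] [Algebra ℝ A]
    (𝒥 : JetAlgebra n A) (a : (Fin n → ℕ) →₀ A) (K : Fin n → ℕ) :
    𝒥.adj a K = ∑ᶠ J : Fin n → ℕ, ((-1 : ℝ) ^ order (K + J) *
      ∏ i, ((K i + J i).choose (K i) : ℝ)) • 𝒥.DD J (a (K + J)) := by
  classical
  have hfin : ∀ a : (Fin n → ℕ) →₀ A, (Function.support fun J : Fin n → ℕ =>
      ((-1 : ℝ) ^ order (K + J) *
        ∏ i, ((K i + J i).choose (K i) : ℝ)) • 𝒥.DD J (a (K + J))).Finite := fun a => by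
    refine ((a.support.finite_toSet).preimage
      ((add_right_injective K).injOn)).subset fun J hJ => ?_
    simp only [Set.mem_preimage, Finset.mem_coe, Finsupp.mem_support_iff]
    intro h
    exact hJ (by simp [h])
  induction a using Finsupp.induction_linear with
  | zero => simp
  | add a b ha hb =>
    rw [map_add, Finsupp.add_apply, ha, hb, ← finsum_add_distrib (hfin a) (hfin b)]
    refine finsum_congr fun J => ?_
    simp
  | single M c =>
    rw [𝒥.adj_single_apply]
    by_cases hKM : K ≤ M
    · obtain ⟨J, rfl⟩ : ∃ J, M = K + J := ⟨M - K, (add_tsub_cancel_of_le hKM).symm⟩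
      rw [finsum_eq_single _ J]
      · simp
      · intro J' hJ'
        rw [Finsupp.single_eq_of_ne (by simpa using hJ'), map_zero, smul_zero]
    · obtain ⟨i, hi⟩ : ∃ i, M i < K i := by simpa [Pi.le_def] using hKM
      rw [Finset.prod_eq_zero (Finset.mem_univ i)
        (by rw [Nat.choose_eq_zero_of_lt hi, Nat.cast_zero]), mul_zero, zero_smul,
        finsum_eq_zero_of_forall_eq_zero]
      intro J
      rw [Finsupp.single_eq_of_ne, map_zero, smul_zero]
      rintro rfl
      simp at hi

theorem JetAlgebra.DD_eq_foldr {A : Type*} [CommRing A] [Algebra ℝ A] (𝒥 : JetAlgebra n A)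
    (J : Fin n → ℕ) (f : A) :
    𝒥.DD J f = (List.finRange n).foldr (fun i g => (𝒥.D i)^[J i] g) f := by
  rw [JetAlgebra.DD]
  induction List.finRange n with
  | nil => rfl
  | cons i l ih =>
    rw [List.map_cons, List.prod_cons, List.foldr_cons, ← ih, Module.End.mul_apply,
      Module.End.pow_apply]
    rfl

/-- The operator `a` on jet space restricts to the operator `α`. -/
def OpRep {Ω : Set (Jet n)} (a : Op n) (α : (Fin n → ℕ) →₀ diffAlg Ω) : Prop :=
  ∀ J, Rep (a J) (α J)

section

variable {Ω : Set (Jet n)}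

theorem rep_zero : Rep (fun _ => 0) (0 : diffAlg Ω) := fun _ => rfl

theorem Rep.smul {F : Jet n → ℝ} {f : diffAlg Ω} (hF : Rep F f) (c : ℝ) :
    Rep (fun z => c * F z) (c • f) := fun z => by
  simp [hF z]

theorem Rep.sum {ι : Type*} {a : ι → Jet n → ℝ} {α : ι → diffAlg Ω} (s : Finset ι)
    (h : ∀ J, Rep (a J) (α J)) : Rep (fun z => ∑ J ∈ s, a J z) (∑ J ∈ s, α J) := by
  classical
  induction s using Finset.induction_on with
  | empty => simpa using rep_zero
  | insert J s hJ ih =>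
    simp only [Finset.sum_insert hJ]
    exact (h J).add ih

theorem Rep.finsum {ι : Type*} {a : ι → Jet n → ℝ} {α : ι → diffAlg Ω} {s : Finset ι}
    (h : ∀ J, Rep (a J) (α J)) (hs : ∀ J, J ∉ s → α J = 0) :
    Rep (fun z => ∑ᶠ J, a J z) (∑ J ∈ s, α J) := by
  refine (Rep.sum s h).congr fun z hz => ?_
  refine finsum_eq_sum_of_support_subset _ fun J hJ => ?_
  by_contra hJs
  apply hJ
  have := h J ⟨z, hz⟩
  rw [hs J hJs] at this
  exact this

variable (hΩ : IsOpen Ω)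

theorem Rep.partialU {F : Jet n → ℝ} {f : diffAlg Ω} (hF : Rep F f) (J : Fin n → ℕ) :
    Rep (partialU J F) ((jetAlgebra hΩ).U J f) := rep_derivU hΩ J hF

theorem Rep.totalD {F : Jet n → ℝ} {f : diffAlg Ω} (hF : Rep F f) (i : Fin n) :
    Rep (totalD i F) ((jetAlgebra hΩ).D i f) := by
  obtain ⟨s, hs⟩ := (jetAlgebra hΩ).exists_support f
  rw [JetAlgebra.D_apply, (jetAlgebra hΩ).vert_eq_sum _ f hs]
  refine Rep.add (F := partialX i F) (rep_derivX hΩ i hF) (Rep.finsum (fun J => ?_)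
    fun J hJ => by rw [hs J hJ, zero_mul])
  rw [mul_comm]
  exact (rep_restr (isDiffFun_coord Ω _)).mul (hF.partialU hΩ J)

theorem Rep.multiD {F : Jet n → ℝ} {f : diffAlg Ω} (hF : Rep F f) (J : Fin n → ℕ) :
    Rep (multiD J F) ((jetAlgebra hΩ).DD J f) := by
  rw [JetAlgebra.DD_eq_foldr, JetCalculus.multiD]
  induction List.finRange n with
  | nil => exact hF
  | cons i l ih =>
    simp only [List.foldr_cons]
    induction J i with
    | zero => exact ih
    | succ m ihm =>
      simp only [Function.iterate_succ_apply']
      exact ihm.totalD hΩ i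

theorem OpRep.app {a : Op n} {α : (Fin n → ℕ) →₀ diffAlg Ω} (ha : OpRep a α) {F : Jet n → ℝ}
    {f : diffAlg Ω} (hF : Rep F f) : Rep (a.app F) ((jetAlgebra hΩ).app f α) := by
  rw [(jetAlgebra hΩ).app_eq_sum f α (s := α.support) fun J hJ => by simpa using hJ]
  refine Rep.finsum (fun J => (ha J).mul (hF.multiD hΩ J)) fun J hJ => ?_
  rw [Finsupp.notMem_support_iff.1 hJ, zero_mul]

theorem OpRep.adj {a : Op n} {α : (Fin n → ℕ) →₀ diffAlg Ω} (ha : OpRep a α) :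
    OpRep a.adj ((jetAlgebra hΩ).adj α) := by
  intro K
  let s : Finset (Fin n → ℕ) := α.support.preimage (fun J => K + J) (add_right_injective K).injOn
  have hs : ∀ J, J ∉ s → α (K + J) = 0 := fun J hJ => by simpa [s] using hJ
  rw [JetAlgebra.adj_apply_eq_finsum, finsum_eq_sum_of_support_subset (s := s)]
  · exact Rep.finsum (fun J => ((ha (K + J)).multiD hΩ J).smul _) fun J hJ => by
      rw [hs J hJ, map_zero, smul_zero]
  · intro J hJ
    by_contra h
    exact hJ (by simp only [hs J h, map_zero, smul_zero])

theorem opRep_frechet {F : Jet n → ℝ} {f : diffAlg Ω} (hF : Rep F f) :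
    OpRep (frechet F) ((jetAlgebra hΩ).dU f) := fun J => hF.partialU hΩ J

theorem OpRep.add {a b : Op n} {α β : (Fin n → ℕ) →₀ diffAlg Ω} (ha : OpRep a α)
    (hb : OpRep b β) : OpRep (a + b) (α + β) := fun J => (ha J).add (hb J)

theorem Rep.pr {F P : Jet n → ℝ} {f p : diffAlg Ω} (hF : Rep F f) (hP : Rep P p) :
    Rep (pr P F) ((jetAlgebra hΩ).pr p f) := by
  obtain ⟨s, hs⟩ := (jetAlgebra hΩ).exists_support f
  rw [JetAlgebra.pr, (jetAlgebra hΩ).vert_eq_sum _ f hs]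
  refine Rep.finsum (fun J => ?_) fun J hJ => by rw [hs J hJ, zero_mul]
  rw [mul_comm]
  exact (hP.multiD hΩ J).mul (hF.partialU hΩ J)

theorem OpRep.prOp {a : Op n} {α : (Fin n → ℕ) →₀ diffAlg Ω} (ha : OpRep a α) {P : Jet n → ℝ}
    {p : diffAlg Ω} (hP : Rep P p) : OpRep (prOp P a) ((jetAlgebra hΩ).prOp p α) :=
  fun J => (ha J).pr hΩ hP

theorem Rep.euler {F : Jet n → ℝ} {f : diffAlg Ω} (hF : Rep F f) :
    Rep (euler F) ((jetAlgebra hΩ).E f) := by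
  obtain ⟨s, hs⟩ := (jetAlgebra hΩ).exists_support f
  rw [JetAlgebra.E, (jetAlgebra hΩ).adjApp_eq_sum 1 _ (s := s) hs]
  refine Rep.finsum (fun J => ?_) fun J hJ => by
    rw [JetAlgebra.dU_apply, hs J hJ, zero_mul, map_zero, smul_zero]
  rw [mul_one]
  exact ((hF.partialU hΩ J).multiD hΩ J).smul _

theorem IsDiffOp.exists_opRep {a : Op n} (ha : IsDiffOp Ω a) :
    ∃ α : (Fin n → ℕ) →₀ diffAlg Ω, OpRep a α := by
  obtain ⟨ha, s, hs⟩ := ha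
  refine ⟨Finsupp.ofSupportFinite (fun J => restr (ha J))
    (s.finite_toSet.subset fun J hJ => ?_), fun J => rep_restr (ha J)⟩
  by_contra h
  exact hJ ((rep_restr (ha J)).eq fun z => hs J h z z.2)

theorem rep_zero_iff {F : Jet n → ℝ} {f : diffAlg Ω} (hF : Rep F f) :
    f = 0 ↔ ∀ z ∈ Ω, F z = 0 := by
  constructor
  · rintro rfl z hz
    exact hF ⟨z, hz⟩
  · intro h
    exact hF.eq fun z => h z z.2

/-- The Euler operator annihilates total divergences. -/
theorem euler_eq_zero_of_isTotalDivergence {F : Jet n → ℝ} (h : IsTotalDivergence Ω F)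
    {z : Jet n} (hz : z ∈ Ω) : euler F z = 0 := by
  obtain ⟨V, hV, hzV, -, A, hA, hF⟩ := h z hz
  have h1 : Rep F (∑ i, (jetAlgebra hV).D i (restr (hA i))) :=
    (Rep.sum Finset.univ fun i => (rep_restr (hA i)).totalD hV i).congr hF
  have h2 := h1.euler hV ⟨z, hzV⟩
  rw [JetAlgebra.E_sum_D] at h2
  exact h2

end

end JetCalculus

/-! ### Parametric integrals and holonomic sections -/

namespace JetCalculus

-- Differentiation under the integral sign: finite dimension makes [0,1] times a closed ball
-- compact, so the derivative has a constant bound.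
open MeasureTheory Set Topology in
theorem hasFDerivAt_parametric_integral {E F : Type*} [NormedAddCommGroup E] [NormedSpace ℝ E]
    [FiniteDimensional ℝ E] [NormedAddCommGroup F] [NormedSpace ℝ F]
    {Φ : ℝ × E → F} {W : Set (ℝ × E)} (hW : IsOpen W) (hΦ : ContDiffOn ℝ 1 Φ W) {U : Set E}
    (hU : IsOpen U) (hUW : ∀ t ∈ Icc (0 : ℝ) 1, ∀ y ∈ U, (t, y) ∈ W) {y₀ : E} (hy₀ : y₀ ∈ U) :
    HasFDerivAt (fun y => ∫ t in (0 : ℝ)..1, Φ (t, y))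
      (∫ t in (0 : ℝ)..1, (fderiv ℝ Φ (t, y₀)).comp (ContinuousLinearMap.inr ℝ ℝ E)) y₀ := by
  have hΙ : uIoc (0 : ℝ) 1 ⊆ Icc 0 1 := by
    rw [uIoc_of_le zero_le_one]; exact Ioc_subset_Icc_self
  have hIcc : uIcc (0 : ℝ) 1 = Icc 0 1 := uIcc_of_le zero_le_one
  have hcont : ∀ y ∈ U, ContinuousOn (fun t : ℝ => Φ (t, y)) (Icc 0 1) := fun y hy =>
    hΦ.continuousOn.comp (by fun_prop) fun t ht => hUW t ht y hy
  have hcd : ContinuousOn (fun p => (fderiv ℝ Φ p).comp (ContinuousLinearMap.inr ℝ ℝ E)) W :=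
    ((hΦ.continuousOn_fderiv_of_isOpen hW le_rfl)).clm_comp continuousOn_const
  obtain ⟨r, hr, hrU⟩ := Metric.nhds_basis_closedBall.mem_iff.1 (hU.mem_nhds hy₀)
  obtain ⟨C, hC⟩ := (isCompact_Icc.prod (isCompact_closedBall y₀ r)).exists_bound_of_continuousOn
    (hcd.mono (s := W) (t := Icc (0 : ℝ) 1 ×ˢ Metric.closedBall y₀ r)
      fun p hp => hUW p.1 hp.1 p.2 (hrU hp.2))
  refine intervalIntegral.hasFDerivAt_integral_of_dominated_of_fderiv_le (bound := fun _ => C)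
    (F := fun y t => Φ (t, y))
    (F' := fun y t => (fderiv ℝ Φ (t, y)).comp (ContinuousLinearMap.inr ℝ ℝ E))
    (Metric.closedBall_mem_nhds y₀ hr) ?_ ?_ ?_ ?_ ?_ ?_
  · filter_upwards [hU.mem_nhds hy₀] with y hy
    exact ((hcont y hy).mono hΙ).aestronglyMeasurable measurableSet_uIoc
  · exact ContinuousOn.intervalIntegrable (by rw [hIcc]; exact hcont y₀ hy₀)
  · refine ContinuousOn.aestronglyMeasurable ?_ measurableSet_uIoc
    exact hcd.comp (f := fun t : ℝ => (t, y₀)) (by fun_prop) fun t ht => hUW t (hΙ ht) y₀ hy₀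
  · exact Filter.Eventually.of_forall fun t ht y hy => hC (t, y) ⟨hΙ ht, hy⟩
  · exact intervalIntegrable_const
  · refine Filter.Eventually.of_forall fun t ht y hy => ?_
    have hd : HasFDerivAt Φ (fderiv ℝ Φ (t, y)) (t, y) :=
      ((hΦ.differentiableOn one_ne_zero).differentiableAt
        (hW.mem_nhds (hUW t (hΙ ht) y (hrU hy)))).hasFDerivAt
    exact hd.comp y (hasFDerivAt_prodMk_right t y)

open Set in
theorem contDiffOn_parametric_integral {E F : Type} [NormedAddCommGroup E] [NormedSpace ℝ E]
    [FiniteDimensional ℝ E] [NormedAddCommGroup F] [NormedSpace ℝ F]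
    {Φ : ℝ × E → F} {W : Set (ℝ × E)} (hW : IsOpen W) (hΦ : ContDiffOn ℝ ∞ Φ W) {U : Set E}
    (hU : IsOpen U) (hUW : ∀ t ∈ Icc (0 : ℝ) 1, ∀ y ∈ U, (t, y) ∈ W) :
    ContDiffOn ℝ ∞ (fun y => ∫ t in (0 : ℝ)..1, Φ (t, y)) U := by
  rw [contDiffOn_infty]
  intro m
  induction m generalizing F with
  | zero =>
    refine contDiffOn_zero.2 fun y hy => ?_
    exact (hasFDerivAt_parametric_integral hW (hΦ.of_le (by norm_cast)) hU hUW
      hy).continuousAt.continuousWithinAt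
  | succ m ih =>
    have hd := fun y (hy : y ∈ U) =>
      hasFDerivAt_parametric_integral hW (hΦ.of_le (by norm_cast)) hU hUW hy
    push_cast
    refine (contDiffOn_succ_iff_fderiv_of_isOpen hU).2
      ⟨fun y hy => (hd y hy).differentiableAt.differentiableWithinAt, by simp, ?_⟩
    -- The derivative is a parametric integral of the same kind with values in linear maps, hence
    -- the induction over varying F.
    refine (ih (Φ := fun p => (fderiv ℝ Φ p).comp (ContinuousLinearMap.inr ℝ ℝ E)) ?_).congr
      fun y hy => (hd y hy).fderiv
    exact (hΦ.fderiv_of_isOpen hW (m := ∞) (by simp)).clm_comp contDiffOn_const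

open Set in
theorem exists_smooth_antiderivative {n : ℕ} (i : Fin n) (c : Fin n → ℝ) (r : ℝ)
    {φ : (Fin n → ℝ) → ℝ} (hφ : ContDiffOn ℝ ∞ φ (Metric.ball c r)) :
    ∃ a : (Fin n → ℝ) → ℝ, ContDiffOn ℝ ∞ a (Metric.ball c r) ∧
      ∀ x ∈ Metric.ball c r, HasDerivAt (fun t => a (Function.update x i t)) (φ x) (x i) := by
  let η : ℝ × (Fin n → ℝ) → Fin n → ℝ := fun p =>
    Function.update p.2 i (c i + p.1 * (p.2 i - c i))
  have hη : ContDiff ℝ ∞ η := by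
    refine contDiff_pi.2 fun j => ?_
    by_cases h : j = i
    · subst h; simp only [η, Function.update_self]; fun_prop
    · simp only [η, Function.update_of_ne h]; fun_prop
  -- Balls for the sup norm are boxes, so moving one coordinate towards the centre stays inside.
  have hball : ∀ x ∈ Metric.ball c r, ∀ τ, |τ - c i| ≤ |x i - c i| →
      Function.update x i τ ∈ Metric.ball c r := by
    intro x hx τ hτ
    have hr : 0 < r := Metric.pos_of_mem_ball hx
    rw [mem_ball_iff_norm, pi_norm_lt_iff hr] at hx ⊢
    intro j
    by_cases h : j = i
    · subst h; simpa using hτ.trans_lt (hx j)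
    · simpa [h] using hx j
  have hmem : ∀ t ∈ Icc (0 : ℝ) 1, ∀ x ∈ Metric.ball c r, (t, x) ∈ η ⁻¹' Metric.ball c r := by
    intro t ht x hx
    refine hball x hx _ ?_
    rw [add_sub_cancel_left, abs_mul, abs_of_nonneg ht.1]
    exact mul_le_of_le_one_left (abs_nonneg _) ht.2
  have hsm := contDiffOn_parametric_integral (Φ := fun p => φ (η p))
    (Metric.isOpen_ball.preimage hη.continuous) (hφ.comp hη.contDiffOn fun p hp => hp)
    Metric.isOpen_ball hmem
  -- The integral from c i to x i rescaled to [0,1]: fixed endpoints make joint smoothness in x a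
  -- case of the parametric integral.
  refine ⟨fun x => (x i - c i) * ∫ t in (0 : ℝ)..1, φ (η (t, x)),
    (ContDiff.contDiffOn (by fun_prop)).mul hsm, fun x hx => ?_⟩
  have heq : ∀ τ : ℝ, (Function.update x i τ i - c i) *
      ∫ t in (0 : ℝ)..1, φ (η (t, Function.update x i τ)) =
      ∫ σ in (c i)..τ, φ (Function.update x i σ) := by
    intro τ
    have := intervalIntegral.smul_integral_comp_add_mul (a := 0) (b := 1)
      (fun σ => φ (Function.update x i σ)) (τ - c i) (c i)
    simp only [smul_eq_mul, mul_zero, add_zero, mul_one, add_sub_cancel] at this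
    rw [← this]
    simp only [η, Function.update_self, Function.update_idem, mul_comm]
  simp only [heq]
  have hcont : ContinuousOn (fun σ => φ (Function.update x i σ))
      {σ | Function.update x i σ ∈ Metric.ball c r} :=
    hφ.continuousOn.comp (by fun_prop) fun σ hσ => hσ
  have hopen : IsOpen {σ | Function.update x i σ ∈ Metric.ball c r} :=
    Metric.isOpen_ball.preimage (by fun_prop)
  have hx' : x i ∈ {σ | Function.update x i σ ∈ Metric.ball c r} := by simpa using hx
  have hsub : uIcc (c i) (x i) ⊆ {σ | Function.update x i σ ∈ Metric.ball c r} :=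
    fun τ hτ => hball x hx τ (abs_sub_left_of_mem_uIcc hτ)
  have := intervalIntegral.integral_hasDerivAt_right (hcont.mono hsub).intervalIntegrable
    (hcont.stronglyMeasurableAtFilter hopen _ hx') (hcont.continuousAt (hopen.mem_nhds hx'))
  simpa using this

/-- A holonomic section of the jet bundle: `w x J` is the derivative `∂_J` of a smooth function
at `x`. -/
structure IsHolonomic {n : ℕ} (w : (Fin n → ℝ) → (Fin n → ℕ) → ℝ) : Prop where
  contDiff : ∀ J, ContDiff ℝ ∞ fun x => w x J
  fderiv : ∀ J x i, fderiv ℝ (fun x => w x J) x (Pi.single i 1) = w x (J + Pi.single i 1)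

/-- The `j`-th derivative of the monomial `t ^ k / k!`. -/
noncomputable def dividedPower (k j : ℕ) (t : ℝ) : ℝ :=
  if j ≤ k then t ^ (k - j) / (k - j).factorial else 0

theorem contDiff_dividedPower (k j : ℕ) : ContDiff ℝ ∞ (dividedPower k j) := by
  unfold dividedPower
  split_ifs <;> fun_prop

theorem hasDerivAt_dividedPower (k j : ℕ) (t : ℝ) :
    HasDerivAt (dividedPower k j) (dividedPower k (j + 1) t) t := by
  unfold dividedPower
  rcases lt_trichotomy j k with h | h | h
  · simp only [h.le, if_true, Nat.succ_le_of_lt h]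
    obtain ⟨m, rfl⟩ : ∃ m, k = j + 1 + m := ⟨k - (j + 1), by omega⟩
    have e1 : j + 1 + m - j = m + 1 := by omega
    have e2 : j + 1 + m - (j + 1) = m := by omega
    rw [e1, e2]
    have := (hasDerivAt_pow (m + 1) t).div_const ((m + 1).factorial : ℝ)
    have e : ((m + 1 : ℕ) : ℝ) * t ^ (m + 1 - 1) / ((m + 1).factorial : ℝ) =
        t ^ m / (m.factorial : ℝ) := by
      rw [Nat.factorial_succ, Nat.cast_mul, Nat.add_sub_cancel]
      exact mul_div_mul_left _ _ (by positivity)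
    rwa [e] at this
  · subst h
    simpa using hasDerivAt_const t (1 : ℝ)
  · simp only [not_le.2 h, if_false, show ¬ j + 1 ≤ k by omega]
    exact hasDerivAt_const t 0

theorem dividedPower_zero (k j : ℕ) : dividedPower k j 0 = if j = k then 1 else 0 := by
  unfold dividedPower
  rcases lt_trichotomy j k with h | h | h
  · simp [h.le, h.ne, Nat.sub_ne_zero_of_lt h]
  · subst h; simp
  · simp [not_le.2 h, h.ne']

/-- The Taylor polynomial at z.1 with coefficients prescribed on T. Finitely many coordinates
suffice, as a neighbourhood in the product topology constrains no more. -/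
theorem exists_isHolonomic {n : ℕ} (z : Jet n) (T : Finset (Fin n → ℕ)) :
    ∃ w, IsHolonomic w ∧ ∀ J ∈ T, w z.1 J = z.2 J := by
  classical
  let q : (Fin n → ℕ) → (Fin n → ℕ) → Fin n → (Fin n → ℝ) → ℝ :=
    fun K J j x => dividedPower (K j) (J j) (x j - z.1 j)
  have hq : ∀ K J j, ContDiff ℝ ∞ (q K J j) := fun K J j =>
    (contDiff_dividedPower _ _).comp (by fun_prop)
  have hsm : ∀ J : Fin n → ℕ, ContDiff ℝ ∞ fun x : Fin n → ℝ =>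
      ∑ K ∈ T, z.2 K * ∏ j, q K J j x := fun J =>
    ContDiff.sum fun K _ => contDiff_const.mul (contDiff_prod fun j _ => hq K J j)
  refine ⟨fun x J => ∑ K ∈ T, z.2 K * ∏ j, q K J j x, ⟨hsm, fun J x i => ?_⟩, fun J hJ => ?_⟩
  · have hcurve : HasDerivAt (fun t : ℝ => Function.update x i t) (Pi.single i 1) (x i) :=
      hasDerivAt_update x i (x i)
    have hx : Function.update x i (x i) = x := Function.update_eq_self i x
    have h1 : HasDerivAt (fun t : ℝ => ∑ K ∈ T, z.2 K * ∏ j, q K J j (Function.update x i t))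
        (_root_.fderiv ℝ (fun x => ∑ K ∈ T, z.2 K * ∏ j, q K J j x) x (Pi.single i 1)) (x i) := by
      have := ((hsm J).differentiable (by simp) (Function.update x i (x i))).hasFDerivAt.comp_hasDerivAt
        (x i) hcurve
      rwa [hx] at this
    refine h1.unique (HasDerivAt.fun_sum fun K _ => HasDerivAt.const_mul _ ?_)
    have hrest : ∀ t, ∏ j, q K J j (Function.update x i t) =
        dividedPower (K i) (J i) (t - z.1 i) * ∏ j ∈ Finset.univ.erase i, q K J j x := fun t => by
      rw [← Finset.mul_prod_erase _ _ (Finset.mem_univ i)]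
      congr 1
      · simp [q]
      · refine Finset.prod_congr rfl fun j hj => ?_
        simp [q, Finset.ne_of_mem_erase hj]
    have hrest' : ∏ j, q K (J + Pi.single i 1) j x =
        dividedPower (K i) (J i + 1) (x i - z.1 i) *
          ∏ j ∈ Finset.univ.erase i, q K J j x := by
      rw [← Finset.mul_prod_erase _ _ (Finset.mem_univ i)]
      congr 1
      · simp [q]
      · refine Finset.prod_congr rfl fun j hj => ?_
        simp [q, Finset.ne_of_mem_erase hj]
    simp only [hrest, hrest']
    refine HasDerivAt.mul_const ?_ _
    exact (hasDerivAt_dividedPower (K i) (J i) (x i - z.1 i)).comp_sub_const (x i) (z.1 i)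
  · simp only [q, sub_self, dividedPower_zero]
    rw [Finset.sum_eq_single J]
    · simp
    · intro K _ hKJ
      obtain ⟨j, hj⟩ := Function.ne_iff.1 hKJ
      rw [Finset.prod_eq_zero (Finset.mem_univ j) (if_neg (Ne.symm hj)), mul_zero]
    · exact fun h => absurd hJ h

end JetCalculus

/-! ### The homotopy along a holonomic section -/

namespace JetCalculus

variable {n : ℕ}

/-- The total derivative at a jet is the derivative along the holonomic direction. -/
theorem totalD_eq_fderiv {Ω : Set (Jet n)} (hΩ : IsOpen Ω) {f : Jet n → ℝ}
    {s : Finset (Fin n → ℕ)} {g : (Fin n → ℝ) × (s → ℝ) → ℝ}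
    (hg : ContDiffOn ℝ ∞ g (proj s '' Ω)) (hf : ∀ z ∈ Ω, f z = g (proj s z)) (i : Fin n)
    {z : Jet n} (hz : z ∈ Ω) :
    totalD i f z =
      fderiv ℝ g (proj s z) (proj s (Pi.single i 1, fun J => z.2 (J + Pi.single i 1))) := by
  have hU : ∀ J, partialU J f z = fderiv ℝ g (proj s z) (proj s (0, Pi.single J 1)) := fun J =>
    (hasDerivAt_partialU hΩ hg hf J hz).deriv
  have hsplit : proj s ((Pi.single i 1, fun J => z.2 (J + Pi.single i 1)) : Jet n) =
      proj s ((Pi.single i 1, 0) : Jet n) +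
      ∑ J ∈ s, z.2 (J + Pi.single i 1) • proj s ((0, Pi.single J 1) : Jet n) := by
    refine Prod.ext ?_ (funext fun K => ?_)
    · simp [proj, Prod.fst_sum]
    · simp [proj, Prod.snd_sum, Finset.sum_apply, Pi.single_apply]
  rw [totalD, partialX, (hasDerivAt_partialX hΩ hg hf i hz).deriv, hsplit, map_add, map_sum,
    finsum_eq_sum_of_support_subset (s := s)]
  · simp only [hU, map_smul, smul_eq_mul]
  · intro J hJ
    by_contra hJs
    apply hJ
    have : proj s ((0, Pi.single J 1) : Jet n) = 0 := by
      refine Prod.ext rfl (funext fun K => ?_)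
      have : (K : Fin n → ℕ) ≠ J := fun h => hJs (h ▸ K.2)
      simp [proj, this]
    simp only [hU, this, map_zero, mul_zero]

/-- The contraction of jet space onto the section `w`. -/
def contraction (w : (Fin n → ℝ) → (Fin n → ℕ) → ℝ) (t : ℝ) (z : Jet n) : Jet n :=
  (z.1, fun J => w z.1 J + t * (z.2 J - w z.1 J))

/-- The contraction in finitely many coordinates. -/
def contractionCoord (w : (Fin n → ℝ) → (Fin n → ℕ) → ℝ) (s : Finset (Fin n → ℕ))
    (p : ℝ × ((Fin n → ℝ) × (s → ℝ))) : (Fin n → ℝ) × (s → ℝ) :=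
  (p.2.1, fun J => w p.2.1 J + p.1 * (p.2.2 J - w p.2.1 J))

theorem proj_contraction (w : (Fin n → ℝ) → (Fin n → ℕ) → ℝ) (s : Finset (Fin n → ℕ)) (t : ℝ)
    (z : Jet n) : proj s (contraction w t z) = contractionCoord w s (t, proj s z) := rfl

theorem contraction_one (w : (Fin n → ℝ) → (Fin n → ℕ) → ℝ) (z : Jet n) :
    contraction w 1 z = z := by
  simp [contraction]

/-- The average of `b` along the contraction onto `w`. -/
noncomputable def avg (w : (Fin n → ℝ) → (Fin n → ℕ) → ℝ) (b : Jet n → ℝ) (z : Jet n) : ℝ :=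
  ∫ t in (0 : ℝ)..1, b (contraction w t z)

section

variable {w : (Fin n → ℝ) → (Fin n → ℕ) → ℝ}

theorem IsHolonomic.contDiff_contractionCoord (hw : IsHolonomic w) (s : Finset (Fin n → ℕ)) :
    ContDiff ℝ ∞ (contractionCoord w s) := by
  have h : ∀ J, ContDiff ℝ ∞ fun p : ℝ × ((Fin n → ℝ) × (s → ℝ)) => w p.2.1 J := fun J =>
    (hw.contDiff J).comp (by fun_prop)
  refine ContDiff.prodMk (by fun_prop) (contDiff_pi.2 fun J => ?_)
  exact (h J).add (contDiff_fst.mul (ContDiff.sub (by fun_prop) (h J)))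

theorem continuous_contraction (z : Jet n) :
    Continuous fun t => contraction w t z := by
  unfold contraction
  fun_prop

theorem continuousOn_comp_contraction (hw : IsHolonomic w) {V : Set (Jet n)}
    (hst : ∀ z ∈ V, ∀ t ∈ Set.Icc (0 : ℝ) 1, contraction w t z ∈ V) {b : Jet n → ℝ}
    (hb : IsDiffFun V b) {z : Jet n} (hz : z ∈ V) :
    ContinuousOn (fun t => b (contraction w t z)) (Set.Icc 0 1) := by
  obtain ⟨s, g, hg, hb⟩ := hb
  have h : ContinuousOn (fun t : ℝ => g (contractionCoord w s (t, proj s z))) (Set.Icc 0 1) :=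
    hg.continuousOn.comp
      ((hw.contDiff_contractionCoord s).continuous.comp (by fun_prop)).continuousOn
      fun t ht => ⟨_, hst z hz t ht, proj_contraction w s t z⟩
  exact h.congr fun t ht => hb _ (hst z hz t ht)

theorem intervalIntegrable_comp_contraction (hw : IsHolonomic w) {V : Set (Jet n)}
    (hst : ∀ z ∈ V, ∀ t ∈ Set.Icc (0 : ℝ) 1, contraction w t z ∈ V) {b : Jet n → ℝ}
    (hb : IsDiffFun V b) {z : Jet n} (hz : z ∈ V) :
    IntervalIntegrable (fun t => b (contraction w t z)) MeasureTheory.volume 0 1 :=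
  ContinuousOn.intervalIntegrable (by
    rw [Set.uIcc_of_le zero_le_one]; exact continuousOn_comp_contraction hw hst hb hz)

theorem avg_congr {V : Set (Jet n)}
    (hst : ∀ z ∈ V, ∀ t ∈ Set.Icc (0 : ℝ) 1, contraction w t z ∈ V) {b c : Jet n → ℝ}
    (h : ∀ z ∈ V, b z = c z) {z : Jet n} (hz : z ∈ V) : avg w b z = avg w c z := by
  refine intervalIntegral.integral_congr fun t ht => ?_
  rw [Set.uIcc_of_le zero_le_one] at ht
  exact h _ (hst z hz t ht)

theorem IsHolonomic.exists_avg_data (hw : IsHolonomic w) {V : Set (Jet n)} (hV : IsOpen V)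
    (hst : ∀ z ∈ V, ∀ t ∈ Set.Icc (0 : ℝ) 1, contraction w t z ∈ V)
    {b : Jet n → ℝ} {s : Finset (Fin n → ℕ)} {g : (Fin n → ℝ) × (s → ℝ) → ℝ}
    (hg : ContDiffOn ℝ ∞ g (proj s '' V)) (hb : ∀ z ∈ V, b z = g (proj s z)) :
    IsOpen (contractionCoord w s ⁻¹' (proj s '' V)) ∧
    ContDiffOn ℝ ∞ (fun p => g (contractionCoord w s p))
      (contractionCoord w s ⁻¹' (proj s '' V)) ∧
    (∀ t ∈ Set.Icc (0 : ℝ) 1, ∀ y ∈ proj s '' V,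
      (t, y) ∈ contractionCoord w s ⁻¹' (proj s '' V)) ∧
    ∀ z ∈ V, avg w b z = ∫ t in (0 : ℝ)..1, g (contractionCoord w s (t, proj s z)) := by
  refine ⟨(isOpen_proj_image hV s).preimage (hw.contDiff_contractionCoord s).continuous,
    hg.comp (hw.contDiff_contractionCoord s).contDiffOn fun p hp => hp, ?_, fun z hz =>
    avg_congr (c := fun z => g (proj s z)) hst hb hz⟩
  rintro t ht _ ⟨z, hz, rfl⟩
  exact ⟨_, hst z hz t ht, proj_contraction w s t z⟩

theorem IsDiffFun.avg (hw : IsHolonomic w) {V : Set (Jet n)} (hV : IsOpen V)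
    (hst : ∀ z ∈ V, ∀ t ∈ Set.Icc (0 : ℝ) 1, contraction w t z ∈ V) {b : Jet n → ℝ}
    (hb : IsDiffFun V b) : IsDiffFun V (avg w b) := by
  obtain ⟨s, g, hg, hb⟩ := hb
  obtain ⟨h1, h2, h3, h4⟩ := hw.exists_avg_data hV hst hg hb
  exact ⟨s, _, contDiffOn_parametric_integral h1 h2 (isOpen_proj_image hV s) h3, h4⟩

/-- For each t, the derivative of the contraction carries the direction of D_i at z to that at the
contracted jet, because D_i w_J = w_{J+i}. Differentiating under the integral then gives the
commutation. -/
theorem totalD_avg (hw : IsHolonomic w) {V : Set (Jet n)} (hV : IsOpen V)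
    (hst : ∀ z ∈ V, ∀ t ∈ Set.Icc (0 : ℝ) 1, contraction w t z ∈ V) {b : Jet n → ℝ}
    (hb : IsDiffFun V b) (i : Fin n) {z : Jet n} (hz : z ∈ V) :
    totalD i (JetCalculus.avg w b) z = JetCalculus.avg w (totalD i b) z := by
  obtain ⟨s, g, hg, hb⟩ := hb
  obtain ⟨h1, h2, h3, h4⟩ := hw.exists_avg_data hV hst hg hb
  have hy : proj s z ∈ proj s '' V := ⟨z, hz, rfl⟩
  have hle : (1 : WithTop ℕ∞) ≤ ∞ := by norm_cast
  have hd := hasFDerivAt_parametric_integral h1 (h2.of_le hle) (isOpen_proj_image hV s) h3 hy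
  have hcd : ContinuousOn (fun t : ℝ => (fderiv ℝ (fun p => g (contractionCoord w s p))
      (t, proj s z)).comp (ContinuousLinearMap.inr ℝ ℝ ((Fin n → ℝ) × (s → ℝ))))
      (Set.uIcc 0 1) := by
    rw [Set.uIcc_of_le zero_le_one]
    exact (((h2.continuousOn_fderiv_of_isOpen h1 hle)).clm_comp continuousOn_const).comp
      (f := fun t : ℝ => (t, proj s z)) (by fun_prop) fun t ht => h3 t ht _ hy
  rw [totalD_eq_fderiv hV
    (contDiffOn_parametric_integral h1 h2 (isOpen_proj_image hV s) h3) h4 i hz, hd.fderiv,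
    ContinuousLinearMap.intervalIntegral_apply hcd.intervalIntegrable]
  refine intervalIntegral.integral_congr fun t ht => ?_
  rw [Set.uIcc_of_le zero_le_one] at ht
  have hmem := hst z hz t ht
  simp only [ContinuousLinearMap.comp_apply, ContinuousLinearMap.inr_apply]
  rw [totalD_eq_fderiv hV hg hb i hmem]
  set v : (Fin n → ℝ) × (s → ℝ) :=
    proj s ((Pi.single i 1, fun J => z.2 (J + Pi.single i 1)) : Jet n) with hv
  have hgd : DifferentiableAt ℝ g (proj s (contraction w t z)) :=
    (hg.differentiableOn (by simp)).differentiableAt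
      ((isOpen_proj_image hV s).mem_nhds ⟨_, hmem, rfl⟩)
  have hcc : DifferentiableAt ℝ (contractionCoord w s) (t, proj s z) :=
    (hw.contDiff_contractionCoord s).differentiable (by simp) _
  have hchain := fderiv_comp (t, proj s z) (g := g) (f := contractionCoord w s) hgd hcc
  rw [show (fun p => g (contractionCoord w s p)) = g ∘ contractionCoord w s from rfl, hchain,
    ContinuousLinearMap.comp_apply]
  -- What remains is that the contraction maps holonomic directions to holonomic directions.
  congr 1
  have hp : HasFDerivAt (fun p : ℝ × ((Fin n → ℝ) × (s → ℝ)) => p.2.1)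
      ((ContinuousLinearMap.fst ℝ _ _).comp (ContinuousLinearMap.snd ℝ _ _)) (t, proj s z) :=
    ((ContinuousLinearMap.fst ℝ (Fin n → ℝ) (s → ℝ)).comp
      (ContinuousLinearMap.snd ℝ ℝ ((Fin n → ℝ) × (s → ℝ)))).hasFDerivAt
  have hwd : ∀ J, HasFDerivAt (fun p : ℝ × ((Fin n → ℝ) × (s → ℝ)) => w p.2.1 J) _
      (t, proj s z) := fun J =>
    (((hw.contDiff J).differentiable (by simp) z.1).hasFDerivAt.comp (t, proj s z) hp :)
  have hsd : ∀ J : s, HasFDerivAt (fun p : ℝ × ((Fin n → ℝ) × (s → ℝ)) => p.2.2 J)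
      ((ContinuousLinearMap.proj J).comp
        ((ContinuousLinearMap.snd ℝ _ _).comp (ContinuousLinearMap.snd ℝ _ _))) (t, proj s z) :=
    fun J => ((ContinuousLinearMap.proj (R := ℝ) (φ := fun _ : s => ℝ) J).comp
      ((ContinuousLinearMap.snd ℝ (Fin n → ℝ) (s → ℝ)).comp
      (ContinuousLinearMap.snd ℝ ℝ ((Fin n → ℝ) × (s → ℝ))))).hasFDerivAt
  have hfst : HasFDerivAt (fun p : ℝ × ((Fin n → ℝ) × (s → ℝ)) => p.1)
      (ContinuousLinearMap.fst ℝ _ _) (t, proj s z) := hasFDerivAt_fst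
  have htot : HasFDerivAt (contractionCoord w s) _ (t, proj s z) :=
    hp.prodMk (hasFDerivAt_pi.2 fun J : s => (hwd J).add (hfst.mul ((hsd J).sub (hwd J))))
  rw [htot.fderiv]
  refine Prod.ext ?_ (funext fun J => ?_)
  · simp [hv, proj]
  · simp [hv, proj, contraction, hw.fderiv]

theorem IsHolonomic.isDiffFun (hw : IsHolonomic w) (V : Set (Jet n)) (J : Fin n → ℕ) :
    IsDiffFun V fun z => w z.1 J :=
  ⟨∅, fun y => w y.1 J, ((hw.contDiff J).comp contDiff_fst).contDiffOn, fun _ _ => rfl⟩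

theorem IsHolonomic.totalD (hw : IsHolonomic w) (i : Fin n) (J : Fin n → ℕ) (z : Jet n) :
    totalD i (fun z => w z.1 J) z = w z.1 (J + Pi.single i 1) := by
  have h := totalD_eq_fderiv (f := fun z => w z.1 J) (Ω := Set.univ) isOpen_univ (s := ∅)
    (g := fun y => w y.1 J) ((hw.contDiff J).comp contDiff_fst).contDiffOn (fun _ _ => rfl) i
    (Set.mem_univ z)
  rw [h, ← hw.fderiv]
  have := fderiv_comp (proj ∅ z) (g := fun x => w x J)
    (f := (Prod.fst : (Fin n → ℝ) × ((∅ : Finset (Fin n → ℕ)) → ℝ) → Fin n → ℝ))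
    ((hw.contDiff J).differentiable (by simp) _) differentiableAt_fst
  rw [show (fun y : (Fin n → ℝ) × ((∅ : Finset (Fin n → ℕ)) → ℝ) => w y.1 J) =
    (fun x => w x J) ∘ Prod.fst from rfl, this]
  simp [proj, fderiv_fst]

/-- Averaging along the contraction, on the algebra of differential functions. -/
noncomputable def avgAlg (hw : IsHolonomic w) {V : Set (Jet n)} (hV : IsOpen V)
    (hst : ∀ z ∈ V, ∀ t ∈ Set.Icc (0 : ℝ) 1, contraction w t z ∈ V) :
    diffAlg V →ₗ[ℝ] diffAlg V where
  toFun f := restr ((isDiffFun_extend f).avg hw hV hst)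
  map_add' f g := by
    refine (rep_restr _).eq (((rep_restr _).add (rep_restr _)).congr fun z hz => ?_)
    rw [avg_congr hst (c := extend f + extend g)
      (fun z hz => (rep_extend (f + g) ⟨z, hz⟩).trans
        (((rep_extend f).add (rep_extend g)) ⟨z, hz⟩).symm) hz]
    exact intervalIntegral.integral_add
      (intervalIntegrable_comp_contraction hw hst (isDiffFun_extend f) hz)
      (intervalIntegrable_comp_contraction hw hst (isDiffFun_extend g) hz)
  map_smul' c f := by
    refine (rep_restr _).eq (((rep_restr _).smul c).congr fun z hz => ?_)
    rw [avg_congr hst (c := fun z => c * extend f z)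
      (fun z hz => (rep_extend (c • f) ⟨z, hz⟩).trans
        (((rep_extend f).smul c) ⟨z, hz⟩).symm) hz]
    exact intervalIntegral.integral_const_mul c _

theorem rep_avgAlg (hw : IsHolonomic w) {V : Set (Jet n)} (hV : IsOpen V)
    (hst : ∀ z ∈ V, ∀ t ∈ Set.Icc (0 : ℝ) 1, contraction w t z ∈ V) {F : Jet n → ℝ}
    {f : diffAlg V} (hF : Rep F f) : Rep (avg w F) (avgAlg hw hV hst f) :=
  (rep_restr ((isDiffFun_extend f).avg hw hV hst)).congr fun _ hz =>
    avg_congr hst (fun z hz => (hF ⟨z, hz⟩).trans (rep_extend f ⟨z, hz⟩).symm) hz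

theorem D_avgAlg (hw : IsHolonomic w) {V : Set (Jet n)} (hV : IsOpen V)
    (hst : ∀ z ∈ V, ∀ t ∈ Set.Icc (0 : ℝ) 1, contraction w t z ∈ V) (i : Fin n)
    (f : diffAlg V) :
    (jetAlgebra hV).D i (avgAlg hw hV hst f) = avgAlg hw hV hst ((jetAlgebra hV).D i f) := by
  refine ((rep_avgAlg hw hV hst (rep_extend f)).totalD hV i).eq
    ((rep_avgAlg hw hV hst ((rep_extend f).totalD hV i)).congr fun z hz => ?_)
  exact totalD_avg hw hV hst (isDiffFun_extend f) i hz

/-- The deviation of `u` from the section `w`. -/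
noncomputable def deviation (hw : IsHolonomic w) (V : Set (Jet n)) : diffAlg V :=
  restr (isDiffFun_coord V 0) - restr (hw.isDiffFun V 0)

theorem rep_DD_deviation (hw : IsHolonomic w) {V : Set (Jet n)} (hV : IsOpen V)
    (J : Fin n → ℕ) :
    Rep (fun z => z.2 J - w z.1 J) ((jetAlgebra hV).DD J (deviation hw V)) := by
  have key : (jetAlgebra hV).DD J (deviation hw V) =
      restr (isDiffFun_coord V J) - restr (hw.isDiffFun V J) := by
    induction J using multiIndex_induction with
    | h0 => rw [JetAlgebra.DD_zero]; rfl
    | hs J i ih =>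
      rw [JetAlgebra.DD_add_single, ih, map_sub]
      congr 1
      · exact (jetAlgebra hV).D_u i J
      · exact ((rep_restr (hw.isDiffFun V J)).totalD hV i).eq
          ((rep_restr (hw.isDiffFun V _)).congr fun z _ => hw.totalD i J z)
  rw [key]
  exact fun z => rfl

theorem app_mapRange_avgAlg (hw : IsHolonomic w) {V : Set (Jet n)} (hV : IsOpen V)
    (hst : ∀ z ∈ V, ∀ t ∈ Set.Icc (0 : ℝ) 1, contraction w t z ∈ V)
    (a : (Fin n → ℕ) →₀ diffAlg V) {z : Jet n} (hz : z ∈ V) :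
    ((jetAlgebra hV).app (deviation hw V)
      (Finsupp.mapRange.linearMap (avgAlg hw hV hst) a)).1 ⟨z, hz⟩ =
    ∫ t in (0 : ℝ)..1, ∑ J ∈ a.support,
      extend (a J) (contraction w t z) * (z.2 J - w z.1 J) := by
  rw [JetAlgebra.app_eq_sum _ _ _ (s := a.support) fun J hJ => by
    simp [Finsupp.notMem_support_iff.1 hJ]]
  rw [intervalIntegral.integral_finsetSum fun J _ =>
    (intervalIntegrable_comp_contraction hw hst (isDiffFun_extend (a J)) hz).mul_const _]
  have := Rep.sum a.support (fun J =>
    (rep_avgAlg hw hV hst (rep_extend (a J))).mul (rep_DD_deviation hw hV J)) ⟨z, hz⟩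
  refine Eq.trans this.symm (Finset.sum_congr rfl fun J _ => ?_)
  exact (intervalIntegral.integral_mul_const _ _).symm

/-- At the contracted jet every D_J(u - w) is t times its value at the original jet. Evaluating the
hypothesis there and dividing by t makes the integrand vanish, so no coefficient of `a` need be
zero. -/
theorem app_mapRange_avgAlg_eq_zero (hw : IsHolonomic w) {V : Set (Jet n)} (hV : IsOpen V)
    (hst : ∀ z ∈ V, ∀ t ∈ Set.Icc (0 : ℝ) 1, contraction w t z ∈ V)
    (a : (Fin n → ℕ) →₀ diffAlg V) (ha : (jetAlgebra hV).app (deviation hw V) a = 0) :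
    (jetAlgebra hV).app (deviation hw V)
      (Finsupp.mapRange.linearMap (avgAlg hw hV hst) a) = 0 := by
  refine Subtype.ext (funext fun z => ?_)
  rw [app_mapRange_avgAlg hw hV hst a z.2]
  refine Eq.trans (intervalIntegral.integral_congr_ae (g := fun _ => (0 : ℝ)) ?_) (by simp)
  refine Filter.Eventually.of_forall fun t ht => ?_
  rw [Set.uIoc_of_le zero_le_one] at ht
  have hmem := hst z z.2 t ⟨ht.1.le, ht.2⟩
  rw [JetAlgebra.app_eq_sum _ _ _ (s := a.support) fun J hJ => by simpa using hJ] at ha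
  have := Rep.sum a.support (fun J =>
    (rep_extend (a J)).mul (rep_DD_deviation hw hV J)) ⟨_, hmem⟩
  rw [ha] at this
  have h0 : t * ∑ J ∈ a.support, extend (a J) (contraction w t z) * (z.1.2 J - w z.1.1 J) = 0 := by
    refine Eq.trans ?_ this
    rw [Finset.mul_sum]
    refine Finset.sum_congr rfl fun J _ => ?_
    simp only [Pi.mul_apply]
    have : (contraction w t z).2 J - w (contraction w t z).1 J = t * (z.1.2 J - w z.1.1 J) := by
      simp [contraction]
    rw [this]; ring
  -- The integral only sees 0 < t, so the factor t can be cancelled.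
  exact (mul_eq_zero.1 h0).resolve_left ht.1.ne'

/-- The fundamental theorem of calculus for t ↦ F(contraction t z), whose velocity in the coordinate
u_J is D_J(u - w). -/
theorem app_mapRange_avgAlg_dU (hw : IsHolonomic w) {V : Set (Jet n)} (hV : IsOpen V)
    (hst : ∀ z ∈ V, ∀ t ∈ Set.Icc (0 : ℝ) 1, contraction w t z ∈ V) {F : Jet n → ℝ}
    {f : diffAlg V} (hF : Rep F f) {z : Jet n} (hz : z ∈ V) :
    F z - F (contraction w 0 z) = ((jetAlgebra hV).app (deviation hw V)
      (Finsupp.mapRange.linearMap (avgAlg hw hV hst) ((jetAlgebra hV).dU f))).1 ⟨z, hz⟩ := by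
  rw [app_mapRange_avgAlg hw hV hst _ hz]
  obtain ⟨s, g, hg, hFg⟩ := hF.isDiffFun
  have hder : ∀ t ∈ Set.uIcc (0 : ℝ) 1, HasDerivAt (fun t => F (contraction w t z))
      (∑ J ∈ ((jetAlgebra hV).dU f).support,
        extend ((jetAlgebra hV).dU f J) (contraction w t z) * (z.2 J - w z.1 J)) t := by
    intro t ht
    rw [Set.uIcc_of_le zero_le_one] at ht
    have hmem := hst z hz t ht
    have hcurve : HasDerivAt (fun t => proj s (contraction w t z))
        (proj s ((0, fun J => z.2 J - w z.1 J) : Jet n)) t := by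
      refine HasDerivAt.prodMk (hasDerivAt_const t z.1) (hasDerivAt_pi.2 fun J => ?_)
      have := ((hasDerivAt_id' t).mul_const (z.2 J - w z.1 J)).const_add (w z.1 J)
      rwa [one_mul] at this
    convert hasDerivAt_comp_curve hV hg hFg (continuous_contraction z).continuousAt hmem
      hcurve using 1
    have hsplit : proj s ((0, fun J => z.2 J - w z.1 J) : Jet n) =
        ∑ J ∈ s, (z.2 J - w z.1 J) • proj s ((0, Pi.single J 1) : Jet n) := by
      refine Prod.ext ?_ (funext fun K => ?_)
      · simp [proj, Prod.fst_sum]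
      · simp [proj, Prod.snd_sum, Finset.sum_apply, Pi.single_apply]
    have hU : ∀ J, extend ((jetAlgebra hV).dU f J) (contraction w t z) =
        fderiv ℝ g (proj s (contraction w t z)) (proj s (0, Pi.single J 1)) := fun J =>
      (rep_extend _ ⟨_, hmem⟩).trans ((hF.partialU hV J ⟨_, hmem⟩).symm.trans
        (hasDerivAt_partialU hV hg hFg J hmem).deriv)
    have hs : ((jetAlgebra hV).dU f).support ⊆ s := by
      intro J hJ
      by_contra hJs
      apply Finsupp.mem_support_iff.1 hJ
      refine (hF.partialU hV J).eq fun y => ?_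
      have : proj s ((0, Pi.single J 1) : Jet n) = 0 := by
        refine Prod.ext rfl (funext fun K => ?_)
        have : (K : Fin n → ℕ) ≠ J := fun h => hJs (h ▸ K.2)
        simp [proj, this]
      rw [partialU, (hasDerivAt_partialU hV hg hFg J y.2).deriv, this, map_zero]
      rfl
    rw [hsplit, map_sum]
    rw [Finset.sum_subset hs fun J _ hJ => by
      rw [Finsupp.notMem_support_iff.1 hJ, show extend (0 : diffAlg V) (contraction w t z) = 0
        from rep_extend 0 ⟨_, hmem⟩, zero_mul]]
    refine Finset.sum_congr rfl fun J _ => ?_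
    rw [hU, map_smul, smul_eq_mul, mul_comm]
  rw [intervalIntegral.integral_eq_sub_of_hasDerivAt hder, contraction_one]
  refine ContinuousOn.intervalIntegrable ?_
  rw [Set.uIcc_of_le zero_le_one]
  exact continuousOn_finsetSum _ fun J _ =>
    (continuousOn_comp_contraction hw hst (isDiffFun_extend _) hz).mul continuousOn_const

end

theorem totalD_comp_fst {a : (Fin n → ℝ) → ℝ} {i : Fin n} {z : Jet n} {c : ℝ}
    (h : HasDerivAt (fun t => a (Function.update z.1 i t)) c (z.1 i)) :
    totalD i (fun z : Jet n => a z.1) z = c := by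
  have h0 : ∀ J, partialU J (fun z : Jet n => a z.1) z = 0 := fun J =>
    deriv_const (z.2 J) (a z.1)
  simp only [totalD, h0, mul_zero, finsum_zero, add_zero]
  exact h.deriv

/-- A small neighbourhood of a jet that is stable under the contraction onto a section. -/
theorem exists_contractible_nhd {Ω : Set (Jet n)} (hΩ : IsOpen Ω) {z : Jet n} (hz : z ∈ Ω) :
    ∃ (V : Set (Jet n)) (w : (Fin n → ℝ) → (Fin n → ℕ) → ℝ) (r : ℝ), IsOpen V ∧ z ∈ V ∧ V ⊆ Ω ∧
      IsHolonomic w ∧ (∀ y ∈ V, ∀ t ∈ Set.Icc (0 : ℝ) 1, contraction w t y ∈ V) ∧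
      (∀ y ∈ V, y.1 ∈ Metric.ball z.1 r) ∧
      ∀ x ∈ Metric.ball z.1 r, ((x, w x) : Jet n) ∈ V := by
  have hΩz := hΩ.mem_nhds hz
  rw [nhds_prod_eq, Filter.mem_prod_iff] at hΩz
  obtain ⟨A, hA, B, hB, hAB⟩ := hΩz
  rw [nhds_pi, Filter.mem_pi'] at hB
  obtain ⟨T, C, hC, hCB⟩ := hB
  choose ε hε hεC using fun J => Metric.mem_nhds_iff.1 (hC J)
  obtain ⟨w, hw, hwz⟩ := exists_isHolonomic z T
  have hnear : ∀ᶠ x in nhds z.1, ∀ J ∈ T, |w x J - z.2 J| < ε J / 2 := by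
    refine (Filter.eventually_all_finset T).2 fun J hJ => ?_
    have := (hw.contDiff J).continuous.continuousAt.eventually (Metric.ball_mem_nhds (w z.1 J)
      (half_pos (hε J)))
    filter_upwards [this] with x hx
    rwa [hwz J hJ, Real.dist_eq] at hx
  obtain ⟨r, hr, hball⟩ := Metric.mem_nhds_iff.1 (Filter.inter_mem hA hnear)
  have hwc : ∀ J, Continuous fun y : Jet n => w y.1 J := fun J =>
    (hw.contDiff J).continuous.comp continuous_fst
  -- A tube around w, convex in each fibre. Half of ε is spent on w staying near z and half on y
  -- staying near w, which keeps the tube in Ω.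
  refine ⟨{y | y.1 ∈ Metric.ball z.1 r ∧ ∀ J ∈ T, |y.2 J - w y.1 J| < ε J / 2}, w, r, ?_, ?_, ?_,
    hw, ?_, fun y hy => hy.1, fun x hx => ⟨hx, fun J _ => by simpa using half_pos (hε J)⟩⟩
  · refine (Metric.isOpen_ball.preimage continuous_fst).inter ?_
    have : {y : Jet n | ∀ J ∈ T, |y.2 J - w y.1 J| < ε J / 2} =
        ⋂ J ∈ T, {y : Jet n | |y.2 J - w y.1 J| < ε J / 2} := by
      ext y; simp
    change IsOpen {y : Jet n | ∀ J ∈ T, |y.2 J - w y.1 J| < ε J / 2}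
    rw [this]
    exact isOpen_biInter_finset fun J _ =>
      isOpen_lt (Continuous.abs (Continuous.sub (by fun_prop) (hwc J))) continuous_const
  · exact ⟨Metric.mem_ball_self hr, fun J hJ => by simpa [hwz J hJ] using half_pos (hε J)⟩
  · rintro y ⟨hy1, hy2⟩
    refine hAB ⟨(hball hy1).1, hCB fun J hJ => hεC J ?_⟩
    rw [Metric.mem_ball, Real.dist_eq]
    have h1 := hy2 J hJ
    have h2 := (hball hy1).2 J hJ
    calc |y.2 J - z.2 J| = |(y.2 J - w y.1 J) + (w y.1 J - z.2 J)| := by ring_nf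
      _ ≤ |y.2 J - w y.1 J| + |w y.1 J - z.2 J| := abs_add_le _ _
      _ < ε J := by linarith
  · rintro y ⟨hy1, hy2⟩ t ht
    refine ⟨hy1, fun J hJ => ?_⟩
    have : (contraction w t y).2 J - w (contraction w t y).1 J = t * (y.2 J - w y.1 J) := by
      simp [contraction]
    rw [this, abs_mul, abs_of_nonneg ht.1]
    exact (mul_le_of_le_one_left (abs_nonneg _) ht.2).trans_lt (hy2 J hJ)

/-! ### The kernel of the Euler operator -/

/-- When E f = 0, the operator f' - ∑ D_i ∘ b_i kills v, hence so does its H-averaged version. As H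
commutes with D_i, that version is the averaged f' minus ∑ D_i ∘ (averaged b_i). -/
theorem JetAlgebra.exists_divergence_of_E_eq_zero {A : Type*} [CommRing A] [Algebra ℝ A]
    (𝒥 : JetAlgebra n A) {v f : A} {H : A →ₗ[ℝ] A} (hf : 𝒥.E f = 0)
    (hv : ∀ a, 𝒥.app v a = 0 → 𝒥.app v (Finsupp.mapRange.linearMap H a) = 0)
    (hH : ∀ i g, 𝒥.D i (H g) = H (𝒥.D i g)) :
    ∃ B : Fin n → A, 𝒥.app v (Finsupp.mapRange.linearMap H (𝒥.dU f)) = ∑ i, 𝒥.D i (B i) := by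
  obtain ⟨b, hb⟩ := 𝒥.exists_integration_by_parts (𝒥.dU f)
  have hcomp : ∀ i a, Finsupp.mapRange.linearMap H (𝒥.comp i a) =
      𝒥.comp i (Finsupp.mapRange.linearMap H a) := by
    intro i a
    induction a using Finsupp.induction_linear with
    | zero => simp
    | add a b ha hb => simp only [map_add, ha, hb]
    | single J c =>
      rw [𝒥.comp_single, map_add, Finsupp.mapRange.linearMap_apply,
        Finsupp.mapRange.linearMap_apply, Finsupp.mapRange.linearMap_apply,
        Finsupp.mapRange_single, Finsupp.mapRange_single, Finsupp.mapRange_single,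
        𝒥.comp_single, hH]
  have hzero : 𝒥.app v (𝒥.dU f - ∑ i, 𝒥.comp i (b i)) = 0 := by
    have := hb v
    rw [show 𝒥.adjApp 1 (𝒥.dU f) = 0 from hf, zero_mul, sub_zero] at this
    rw [map_sub, this, map_sum, sub_eq_zero]
    exact Finset.sum_congr rfl fun i _ => (𝒥.app_comp i _ _).symm
  have h := hv _ hzero
  rw [map_sub, map_sum, map_sub, map_sum, sub_eq_zero] at h
  simp only [hcomp, 𝒥.app_comp] at h
  exact ⟨_, h⟩

/-- A differential function that the Euler operator annihilates is locally a total divergence. -/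
theorem isTotalDivergence_of_euler_eq_zero (hn : 1 ≤ n) {Ω : Set (Jet n)} (hΩ : IsOpen Ω)
    {F : Jet n → ℝ} (hF : IsDiffFun Ω F) (h : ∀ z ∈ Ω, euler F z = 0) :
    IsTotalDivergence Ω F := by
  classical
  intro z hz
  obtain ⟨V, w, r, hV, hzV, hVΩ, hw, hst, hVr, hrV⟩ := exists_contractible_nhd hΩ hz
  refine ⟨V, hV, hzV, hVΩ, ?_⟩
  have hFV := hF.mono hVΩ
  have hf := rep_restr hFV
  set f := restr hFV
  have hE : (jetAlgebra hV).E f = 0 := (rep_zero_iff (hf.euler hV)).2 fun y hy => h y (hVΩ hy)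
  obtain ⟨B, hB⟩ := (jetAlgebra hV).exists_divergence_of_E_eq_zero hE
    (app_mapRange_avgAlg_eq_zero hw hV hst) (D_avgAlg hw hV hst)
  obtain ⟨s, g, hg, hFg⟩ := hFV
  have hφ : ContDiffOn ℝ ∞ (fun x => F (x, w x)) (Metric.ball z.1 r) := by
    have : ContDiff ℝ ∞ fun x : Fin n → ℝ => proj s ((x, w x) : Jet n) :=
      contDiff_id.prodMk (contDiff_pi.2 fun J => hw.contDiff J)
    exact (hg.comp this.contDiffOn fun x hx => ⟨_, hrV x hx, rfl⟩).congr
      fun x hx => hFg _ (hrV x hx)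
  -- The leftover F(x, w x) is a function of x alone; its antiderivative in a single variable,
  -- available since n ≥ 1, is added to one component.
  let k : Fin n := ⟨0, hn⟩
  obtain ⟨a, ha, hda⟩ := exists_smooth_antiderivative k z.1 r hφ
  have haV : IsDiffFun V fun y => a y.1 := by
    refine ⟨∅, fun y => a y.1, ha.comp contDiff_fst.contDiffOn ?_, fun _ _ => rfl⟩
    rintro _ ⟨y, hy, rfl⟩
    exact hVr y hy
  let A : Fin n → diffAlg V := fun i =>
    B i + (Pi.single k (restr haV) : Fin n → diffAlg V) i
  refine ⟨fun i => extend (A i), fun i => isDiffFun_extend _, fun y hy => ?_⟩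
  have h1 := Rep.sum Finset.univ (fun i => (rep_extend (A i)).totalD hV i) ⟨y, hy⟩
  refine Eq.trans ?_ h1.symm
  have h2 := app_mapRange_avgAlg_dU hw hV hst hf hy
  rw [hB] at h2
  have h3 : ∑ i, (jetAlgebra hV).D i (A i) =
      ∑ i, (jetAlgebra hV).D i (B i) + (jetAlgebra hV).D k (restr haV) := by
    have h5 : ∀ i, (jetAlgebra hV).D i (A i) = (jetAlgebra hV).D i (B i) +
        if i = k then (jetAlgebra hV).D i (restr haV) else 0 := fun i => by
      by_cases hi : i = k
      · subst hi
        rw [if_pos rfl, ← Derivation.map_add]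
        simp only [A, Pi.single_eq_same]
      · rw [if_neg hi, add_zero]
        simp only [A, Pi.single_eq_of_ne hi, add_zero]
    rw [Finset.sum_congr rfl fun i _ => h5 i, Finset.sum_add_distrib]
    congr 1
    exact (Finset.sum_ite_eq' _ _ _).trans (if_pos (Finset.mem_univ k))
  have h4 : F (contraction w 0 y) = ((jetAlgebra hV).D k (restr haV)).1 ⟨y, hy⟩ := by
    rw [← (rep_restr haV).totalD hV k ⟨y, hy⟩, totalD_comp_fst (hda y.1 (hVr y hy))]
    simp only [contraction, zero_mul, add_zero]
  rw [h3]
  change F y = _ + _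
  rw [← h4, ← h2]
  ring

end JetCalculus

/-! ### The criterion -/

theorem proposition4p5 {n : ℕ} (hn : 1 ≤ n)
    (Ω : Set (JetCalculus.Jet n)) (hΩ : IsOpen Ω)
    (L G : JetCalculus.Jet n → ℝ) (hL : JetCalculus.IsDiffFun Ω L)
    (hG : ∀ z ∈ Ω, G z = JetCalculus.euler L z)
    (Q : JetCalculus.Jet n → ℝ) (hQ : JetCalculus.IsDiffFun Ω Q)
    (R : JetCalculus.Op n) (hR : JetCalculus.IsDiffOp Ω R)
    (hsymm : ∀ z ∈ Ω, (JetCalculus.frechet G).app Q z = R.app G z)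
    (P : JetCalculus.Jet n → ℝ) (hP : JetCalculus.IsVariationalSymmetry Ω L P) :
    JetCalculus.IsVariationalSymmetry Ω L ((JetCalculus.recursionOp R Q).app P) ↔
      ∀ z ∈ Ω,
        (JetCalculus.recursionOp R Q).adj.app ((JetCalculus.frechet P).adj.app G) z -
            (JetCalculus.frechet P).adj.app ((JetCalculus.recursionOp R Q).adj.app G) z =
          (JetCalculus.prOp P (JetCalculus.recursionOp R Q).adj).app G z := by
  open JetCalculus in
  have hl := rep_restr hL
  have hq := rep_restr hQ
  have hp := rep_restr hP.1
  obtain ⟨r, hr⟩ := hR.exists_opRep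
  have hg : Rep G ((jetAlgebra hΩ).E (restr hL)) := (hl.euler hΩ).congr hG
  have hQ' := ((opRep_frechet hΩ hg).app hΩ hq).eq ((hr.app hΩ hg).congr hsymm)
  have hP' : (jetAlgebra hΩ).E ((jetAlgebra hΩ).pr (restr hP.1) (restr hL)) = 0 :=
    (rep_zero_iff ((hl.pr hΩ hp).euler hΩ)).2 fun z hz =>
      euler_eq_zero_of_isTotalDivergence hP.2 hz
  have hS : OpRep (recursionOp R Q) _ := (hr.adj hΩ).add (opRep_frechet hΩ hq)
  have hSP := hS.app hΩ hp
  have hprSP := hl.pr hΩ hSP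
  have hE := hprSP.euler hΩ
  have hP'' := (opRep_frechet hΩ hp).adj hΩ
  have h1 := (hS.adj hΩ).app hΩ (hP''.app hΩ hg)
  have h2 := hP''.app hΩ ((hS.adj hΩ).app hΩ hg)
  have h3 := ((hS.adj hΩ).prOp hΩ hp).app hΩ hg
  have key := (jetAlgebra hΩ).E_pr_recursion (restr hL) (restr hQ) (restr hP.1) r hQ' hP'
  rw [key] at hE
  -- After rewriting by `key`, vanishing of E(pr X_{SP} L) on Ω is the operator identity in the
  -- algebra; the two implications then use the two directions of the description of ker E.
  have hiff : (∀ z ∈ Ω, euler (pr ((recursionOp R Q).app P) L) z = 0) ↔ _ :=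
    (rep_zero_iff hE).symm.trans sub_eq_zero
  constructor
  · intro h z hz
    have h4 := hiff.1 fun z hz => euler_eq_zero_of_isTotalDivergence h.2 hz
    rw [h3 ⟨z, hz⟩, h1 ⟨z, hz⟩, h2 ⟨z, hz⟩, h4]
    rfl
  · intro h
    refine ⟨hSP.isDiffFun, isTotalDivergence_of_euler_eq_zero hn hΩ hprSP.isDiffFun
      (hiff.2 (Subtype.ext (funext fun z => ?_)))⟩
    rw [← h3 z, ← h z z.2, h1 z, h2 z]
    rfl
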